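/- **Setting.** Fix real numbers $F\ge 1$, $K\ge 0$, $G\ge 1$, $H\ge 2$. Partially defined seminorms are extended by $\infty$ outside their domains. For a unital C*-algebra $\mathfrak A$, let $\mathfrak{sa}(\mathfrak A)$ be its self-adjoint part and $\mathscr S(\mathfrak A)$ its state space. For a distance function $d$, write $\overrightarrow{\mathsf{Haus}}_d(S\to T)=\sup_{x\in S}\inf_{y\in T}d(x,y)$, and let $\mathsf{Haus}_d(S,T)$ be the maximum of $\overrightarrow{\mathsf{Haus}}_d(S\to T)$ and $\overrightarrow{\mathsf{Haus}}_d(T\to S)$. *Quantum compact metric spaces.* An $(F,K)$-quantum compact metric space $(\mathfrak A,\mathsf L)$ is a unital C*-algebra with a seminorm $\mathsf L$ defined on a dense subspace of $\mathfrak{sa}(\mathfrak A)$ such that: $\mathsf L(1)=0$; $\{\mathsf L\le 1\}$ is closed; $\mathsf{mk}_{\mathsf L}(\varphi,\psi)=\sup\{|\varphi(a)-\psi(a)|:\mathsf L(a)\le 1\}$ is a metric on $\mathscr S(\mathfrak A)$ inducing the weak* topology; and $\max\{\mathsf L(\Re(ab)),\mathsf L(\Im(ab))\}\le F(\mathsf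 L(a)\|b\|+\|a\|\mathsf L(b))+K\mathsf L(a)\mathsf L(b)$ for $a,b$ in the domain of $\mathsf L$. *Metrical C\*-correspondences.* A metrical C*-correspondence $(\mathscr M,\mathsf D,\mathfrak A,\mathsf L,\mathfrak B,\mathsf S)$ consists of two $(F,K)$-quantum compact metric spaces $(\mathfrak A,\mathsf L)$, $(\mathfrak B,\mathsf S)$, a right Hilbert $\mathfrak B$-module $\mathscr M$ with a unital *-morphism from $\mathfrak A$ to the adjointable operators of $\mathscr M$, and a norm $\mathsf D$ on a dense complex subspace of $\mathscr M$ such that $\mathsf D\ge\|\cdot\|_{\mathscr M}$, $\{\mathsf D\le 1\}$ is norm compact, $\mathsf D(a\omega)\le G(\|a\|+\mathsf L(a))\mathsf D(\omega)$ for $a$ in the domain of $\mathsf L$ and $\omega$ in the domain of $\mathsf D$, and $\max\{\mathsf S(\Re\langle\omega,\eta\rangle),\mathsf S(\Im\langle\omega,\eta\rangle)\}\le H\,\mathsf D(\omega)\mathsf D(\eta)$ for $\omega,\eta$ in the domain of $\mathsf D$. *Tunnels.* A tunnel $\tau$ from $\mathbb M_1$ to $\mathbb M_2$ is a metrical C*-correspondence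 $\mathbb P=(\mathscr P,\mathsf{T},\mathfrak D,\mathsf L_{\mathfrak D},\mathfrak E,\mathsf L_{\mathfrak E})$ with two modular quantum isometries $(\Pi_j,\pi_j,\theta_j):\mathbb P\to\mathbb M_j$, $j=1,2$: here $\Pi_j$ is continuous and linear between the modules, $\pi_j,\theta_j$ are unital *-morphisms between the left and the right C*-algebras, these maps intertwine the left and right actions and the inner products and send domains of the (semi)norms into domains, and, on its domain, each of the three (semi)norms of $\mathbb M_j$ is the quotient of the corresponding one of $\mathbb P$ (for example $\mathsf D_j(\omega)=\inf\{\mathsf T(\eta):\Pi_j(\eta)=\omega\}$). Its extent is $$\chi(\tau)=\max_{j=1,2}\max\bigl\{\mathsf{Haus}_{\mathsf{mk}_{\mathsf L_{\mathfrak D}}}(\{\varphi\circ\pi_j:\varphi\in\mathscr S(\mathfrak A_j)\},\mathscr S(\mathfrak D)),\ \mathsf{Haus}_{\mathsf{mk}_{\mathsf L_{\mathfrak E}}}(\{\psi\circ\theta_j:\psi\in\mathscr S(\mathfrak B_j)\},\mathscr S(\mathfrak E))\bigr\}.$$ For families $\Phi=(\Phi_j)_{j\in J}$, $\Psi=(\Psi_j)_{j\in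 J}$ of continuous linear functionals on $\mathscr P$, set $k_{\mathsf T}(\Phi,\Psi)=\sup_{j\in J}\sup_{\mathsf T(\omega)\le 1}|\Phi_j(\omega)-\Psi_j(\omega)|$. The reversed tunnel, with the two isometries exchanged, is $\tau^{-1}$. *Operational propinquity.* A pseudo-state of $\mathbb M$ is a functional $\mu(\langle\omega,\cdot\rangle)$ with $\mu\in\mathscr S(\mathfrak B)$ and $\mathsf D(\omega)\le 1$. For families $a=(a_j)_{j\in J}$, $b=(b_j)_{j\in J}$ of adjointable operators on the modules of $\mathbb M_1$, $\mathbb M_2$, the operational propinquity $\Lambda^{\mathrm{op}}(a,b)$ is the infimum, over all tunnels $\tau$ from $\mathbb M_1$ to $\mathbb M_2$, of $$\max\Bigl\{\chi(\tau),\ \mathsf{Haus}_{k_{\mathsf T}}\bigl(\{(\varphi\circ a_j\circ\Pi_1)_{j}:\varphi\text{ a pseudo-state of }\mathbb M_1\},\{(\psi\circ b_j\circ\Pi_2)_{j}:\psi\text{ a pseudo-state of }\mathbb M_2\}\bigr)\Bigr\}.$$ A single operator is regarded as a family with one member. *Spectral triples.* A spectral triple $(\mathfrak A,\mathscr H,D)$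 is a unital C*-algebra $\mathfrak A$ with a unital *-representation on a Hilbert space $\mathscr H$ and a self-adjoint, possibly unbounded, operator $D$ on $\mathscr H$ such that $D+i$ has a compact inverse and the set of those $a\in\mathfrak{sa}(\mathfrak A)$ for which $a\,\mathrm{dom}(D)\subseteq\mathrm{dom}(D)$ and $[D,a]$ is bounded is dense in $\mathfrak{sa}(\mathfrak A)$; on this set let $\mathsf L_D(a)=\|[D,a]\|$. It is metric when $(\mathfrak A,\mathsf L_D)$ is a $(1,0)$-quantum compact metric space. Then $(\mathscr H,\mathsf D_D,\mathfrak A,\mathsf L_D,\mathbb C,0)$, with $\mathsf D_D(\xi)=\|\xi\|+\|D\xi\|$ on $\mathrm{dom}(D)$, is a metrical C*-correspondence; tunnels between metric spectral triples, and the operational propinquity between bounded operators on their Hilbert spaces, refer to these correspondences. *Spectral propinquity.* For $\varepsilon>0$, an $\varepsilon$-iso-iso is a pair of maps $\varsigma_1,\varsigma_2:[0,\infty)\to[0,\infty)$ with $\varsigma_1(0)=\varsigma_2(0)=0$ and $\bigl||\varsigma_j(x)+\varsigma_j(y)-z|-|x+y-\varsigma_k(z)|\bigr|<\varepsilon$ for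 all $x,y,z\in[0,\frac1\varepsilon]$ and $\{j,k\}=\{1,2\}$. For a tunnel $\tau$ between metric spectral triples $(\mathfrak A_j,\mathscr H_j,D_j)$, $j=1,2$, put $$\rho(\tau,\varsigma,\varepsilon)=\overrightarrow{\mathsf{Haus}}_{k_{\mathsf T}}\Bigl(\bigl\{(\langle e^{-itD_1}\xi,\Pi_1(\cdot)\rangle)_{0\le t\le\frac1\varepsilon}:\mathsf D_{D_1}(\xi)\le 1\bigr\}\to\bigl\{(\langle e^{-i\varsigma(t)D_2}\eta,\Pi_2(\cdot)\rangle)_{0\le t\le\frac1\varepsilon}:\mathsf D_{D_2}(\eta)\le 1\bigr\}\Bigr).$$ The spectral propinquity $\Lambda^{\mathrm{spec}}$ between the two triples is the infimum of $\frac{\sqrt2}2$ and of all $\varepsilon>0$ for which there exist a tunnel $\tau$ from the first to the second and an $\varepsilon$-iso-iso $(\varsigma_1,\varsigma_2)$ with $\max\{\chi(\tau),\rho(\tau,\varsigma_1,\varepsilon),\rho(\tau^{-1},\varsigma_2,\varepsilon)\}<\varepsilon$. **Statement.** Let $(\mathfrak A_n,\mathscr H_n,D_n)_{n\in\mathbb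 N}$ be a sequence of metric spectral triples which converges for the spectral propinquity to a metric spectral triple $(\mathfrak A_\infty,\mathscr H_\infty,D_\infty)$, that is, $$\lim_{n\to\infty}\Lambda^{\mathrm{spec}}\bigl((\mathfrak A_n,\mathscr H_n,D_n),(\mathfrak A_\infty,\mathscr H_\infty,D_\infty)\bigr)=0.$$ Then, for every $\lambda\in\mathbb C\setminus\mathbb R$, $$\lim_{n\to\infty}\Lambda^{\mathrm{op}}\bigl((D_n-\lambda)^{-1},(D_\infty-\lambda)^{-1}\bigr)=0.$$ -/

import Mathlib

universe u v w

namespace SpectralPropinquity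

open scoped ENNReal NNReal ComplexStarModule ComplexOrder
open Filter Topology

/-! ### Resolvents of self-adjoint operators -/

section UnboundedOperators

variable {H : Type*} [NormedAddCommGroup H] [InnerProductSpace ℂ H]

/-- The bounded operator `R` is the inverse of `D - z`. -/
structure IsResolventAt (D : H →ₗ.[ℂ] H) (z : ℂ) (R : H →L[ℂ] H) : Prop where
  right_inv : ∀ η : H, ∃ x : D.domain, (x : H) = R η ∧ D x - z • (x : H) = η
  left_inv : ∀ x : D.domain, R (D x - z • (x : H)) = x

variable [CompleteSpace H] {D : H →ₗ.[ℂ] H}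

theorem inner_symm_of_selfAdjoint (hD : IsSelfAdjoint D) (x y : D.domain) :
    inner ℂ (D x) (y : H) = inner ℂ (x : H) (D y) := by
  have h := LinearPMap.adjoint_isFormalAdjoint (T := D) hD.dense_domain
  rw [LinearPMap.isSelfAdjoint_def.mp hD] at h
  exact h x y

theorem im_mul_norm_le (hD : IsSelfAdjoint D) (z : ℂ) (x : D.domain) :
    |z.im| * ‖(x : H)‖ ≤ ‖D x - z • (x : H)‖ := by
  by_cases hx : (x : H) = 0
  · simp [hx]
  have hpos : 0 < ‖(x : H)‖ := norm_pos_iff.mpr hx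
  have h1 : (inner ℂ (x : H) (D x - z • (x : H))).im = - z.im * ‖(x : H)‖ ^ 2 := by
    have h2 : (inner ℂ (x : H) (D x)).im = 0 := by
      have h := inner_symm_of_selfAdjoint hD x x
      rw [← inner_conj_symm] at h
      have := congrArg Complex.im h
      simp only [Complex.conj_im] at this
      linarith
    have h3 : inner ℂ (x : H) (x : H) = ((‖(x : H)‖ ^ 2 : ℝ) : ℂ) := by
      rw [inner_self_eq_norm_sq_to_K]; norm_cast
    rw [inner_sub_right, inner_smul_right, h3, Complex.sub_im, h2, Complex.im_mul_ofReal]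
    ring
  have h4 : |z.im| * ‖(x : H)‖ ^ 2 ≤ ‖(x : H)‖ * ‖D x - z • (x : H)‖ := by
    calc |z.im| * ‖(x : H)‖ ^ 2 = |(inner ℂ (x : H) (D x - z • (x : H))).im| := by
          rw [h1, abs_mul, abs_neg, abs_of_nonneg (sq_nonneg ‖(x : H)‖)]
      _ ≤ ‖inner ℂ (x : H) (D x - z • (x : H))‖ := Complex.abs_im_le_norm _
      _ ≤ _ := norm_inner_le_norm _ _
  nlinarith

theorem exists_isResolventAt (hD : IsSelfAdjoint D) {z : ℂ} (hz : z.im ≠ 0) :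
    ∃ R : H →L[ℂ] H, IsResolventAt D z R := by
  have hzpos : 0 < |z.im| := abs_pos.mpr hz
  have hcl : IsClosed (D.graph : Set (H × H)) := hD.isClosed
  have : CompleteSpace D.graph := hcl.completeSpace_coe
  let T : D.graph →L[ℂ] H :=
    (ContinuousLinearMap.snd ℂ H H - z • ContinuousLinearMap.fst ℂ H H).comp D.graph.subtypeL
  have hT : ∀ x : D.domain, T ⟨((x : H), D x), D.mem_graph x⟩ = D x - z • (x : H) := fun x => rfl
  have hsurj : ∀ p : D.graph, ∃ x : D.domain, p = ⟨((x : H), D x), D.mem_graph x⟩ := by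
    rintro ⟨⟨a, b⟩, hp⟩
    obtain ⟨x, hx⟩ := (D.mem_graph_iff).mp hp
    exact ⟨x, Subtype.ext (Prod.ext hx.1.symm hx.2.symm)⟩
  have hbound : ∀ p : D.graph, ‖p‖ ≤ ((1 + (1 + ‖z‖) / |z.im| : ℝ)) * ‖T p‖ := by
    intro p
    obtain ⟨x, rfl⟩ := hsurj p
    rw [hT]
    have h1 := im_mul_norm_le hD z x
    have h2 : ‖(x : H)‖ ≤ ‖D x - z • (x : H)‖ / |z.im| := by
      rw [le_div_iff₀ hzpos]; linarith
    have h3 : ‖D x‖ ≤ ‖D x - z • (x : H)‖ + ‖z‖ * ‖(x : H)‖ := by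
      have := norm_add_le (D x - z • (x : H)) (z • (x : H))
      rwa [sub_add_cancel, norm_smul] at this
    have h4 : (1 + (1 + ‖z‖) / |z.im|) * ‖D x - z • (x : H)‖ =
        ‖D x - z • (x : H)‖ + ‖D x - z • (x : H)‖ / |z.im|
          + ‖z‖ * (‖D x - z • (x : H)‖ / |z.im|) := by ring
    have h5 : ‖z‖ * ‖(x : H)‖ ≤ ‖z‖ * (‖D x - z • (x : H)‖ / |z.im|) := by gcongr
    have h6 : 0 ≤ ‖D x - z • (x : H)‖ / |z.im| := by positivity
    have h7 : 0 ≤ ‖z‖ * (‖D x - z • (x : H)‖ / |z.im|) := by positivity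
    have h8 := norm_nonneg (D x - z • (x : H))
    rw [h4]
    change max ‖(x : H)‖ ‖D x‖ ≤ _
    exact max_le (by linarith) (by linarith)
  have hanti : AntilipschitzWith (Real.toNNReal (1 + (1 + ‖z‖) / |z.im|)) T := by
    refine ContinuousLinearMap.antilipschitz_of_bound T fun p => ?_
    rw [Real.coe_toNNReal _ (by positivity)]
    exact hbound p
  have hrc : IsClosed (Set.range T) := hanti.isClosed_range T.uniformContinuous
  have hrc' : IsClosed ((LinearMap.range (T : D.graph →ₗ[ℂ] H) : Submodule ℂ H) : Set H) := by
    rw [LinearMap.coe_range]; exact hrc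
  have hrange : LinearMap.range (T : D.graph →ₗ[ℂ] H) = ⊤ := by
    have : CompleteSpace (LinearMap.range (T : D.graph →ₗ[ℂ] H)) := hrc'.completeSpace_coe
    rw [← Submodule.orthogonal_eq_bot_iff, Submodule.eq_bot_iff]
    intro y hy
    have hy' : ∀ x : D.domain, inner ℂ ((starRingEnd ℂ z) • y) (x : H) = inner ℂ y (D x) := by
      intro x
      have h := (Submodule.mem_orthogonal' _ _).mp hy (D x - z • (x : H))
        ⟨⟨((x : H), D x), D.mem_graph x⟩, rfl⟩
      rw [inner_sub_right, inner_smul_right, sub_eq_zero] at h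
      rw [inner_smul_left, h, Complex.conj_conj]
    have hdom : y ∈ D.adjoint.domain := LinearPMap.mem_adjoint_domain_of_exists y ⟨_, hy'⟩
    have happ : D.adjoint ⟨y, hdom⟩ = (starRingEnd ℂ z) • y :=
      LinearPMap.adjoint_apply_eq hD.dense_domain _ hy'
    have key : ∀ (S : H →ₗ.[ℂ] H), S = D → ∀ h : y ∈ S.domain, S ⟨y, h⟩ = (starRingEnd ℂ z) • y →
        y = 0 := by
      rintro S rfl h hS
      have := im_mul_norm_le hD (starRingEnd ℂ z) ⟨y, h⟩
      rw [hS, sub_self, norm_zero, Complex.conj_im, abs_neg] at this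
      have h0 : ‖y‖ ≤ 0 := by
        by_contra hc
        push Not at hc
        have := mul_pos hzpos hc
        simp only at *
        linarith
      simpa using h0
    exact key _ (LinearPMap.isSelfAdjoint_def.mp hD) hdom happ
  have hker : LinearMap.ker (T : D.graph →ₗ[ℂ] H) = ⊥ :=
    LinearMap.ker_eq_bot.mpr hanti.injective
  let e := ContinuousLinearEquiv.ofBijective T hker hrange
  have he : ∀ p, e p = T p := fun p => rfl
  refine ⟨(ContinuousLinearMap.fst ℂ H H).comp (D.graph.subtypeL.comp
    (e.symm : H →L[ℂ] D.graph)), ⟨fun η => ?_, fun x => ?_⟩⟩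
  · obtain ⟨x, hx⟩ := hsurj (e.symm η)
    refine ⟨x, ?_, ?_⟩
    · simp [hx]
    · rw [← hT, ← hx, ← he, e.apply_symm_apply]
  · have : e.symm (D x - z • (x : H)) = ⟨((x : H), D x), D.mem_graph x⟩ := by
      rw [← hT, ← he, e.symm_apply_apply]
    simp [this]

/-! ### The unitary group generated by a self-adjoint operator -/

/-- `U t = exp (i t D)`: `U` is the strongly continuous one-parameter group of unitaries with
generator `i D` (by Stone's theorem, it is determined by the self-adjoint operator `D`). -/
structure IsUnitaryGroupOf (D : H →ₗ.[ℂ] H) (U : ℝ → H →L[ℂ] H) : Prop where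
  zero : U 0 = 1
  add : ∀ s t : ℝ, U (s + t) = U s * U t
  unitary : ∀ t : ℝ, U t ∈ unitary (H →L[ℂ] H)
  continuous : ∀ ξ : H, Continuous fun t => U t ξ
  hasDerivAt : ∀ ξ : D.domain, HasDerivAt (fun t => U t (ξ : H)) (Complex.I • D ξ) 0

section Bounded

/-- `exp (i t C)` for bounded `C`. -/
noncomputable def expI (C : H →L[ℂ] H) (t : ℝ) : H →L[ℂ] H :=
  NormedSpace.exp (t • (Complex.I • C))

theorem expI_zero (C : H →L[ℂ] H) : expI C 0 = 1 := by simp [expI]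

theorem expI_add (C : H →L[ℂ] H) (s t : ℝ) : expI C (s + t) = expI C s * expI C t := by
  let +nondep : NormedAlgebra ℚ (H →L[ℂ] H) := .restrictScalars ℚ ℂ _
  unfold expI
  rw [add_smul, NormedSpace.exp_add_of_commute]
  exact ((Commute.refl _).smul_left _).smul_right _

theorem expI_mem_unitary {C : H →L[ℂ] H} (hC : IsSelfAdjoint C) (t : ℝ) :
    expI C t ∈ unitary (H →L[ℂ] H) := by
  let +nondep : NormedAlgebra ℚ (H →L[ℂ] H) := .restrictScalars ℚ ℂ _
  unfold expI
  apply NormedSpace.exp_mem_unitary_of_mem_skewAdjoint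
  rw [skewAdjoint.mem_iff]
  simp [hC.star_eq]

theorem norm_expI {C : H →L[ℂ] H} (hC : IsSelfAdjoint C) (t : ℝ) (ξ : H) :
    ‖expI C t ξ‖ = ‖ξ‖ :=
  ContinuousLinearMap.norm_map_of_mem_unitary (expI_mem_unitary hC t) ξ

theorem hasDerivAt_expI (C : H →L[ℂ] H) (t : ℝ) (ξ : H) :
    HasDerivAt (fun s => expI C s ξ) (expI C t (Complex.I • C ξ)) t := by
  have h := hasDerivAt_exp_smul_const (𝕂 := ℝ) (Complex.I • C) t
  exact (((ContinuousLinearMap.apply ℂ H ξ).restrictScalars ℝ).hasFDerivAt.comp_hasDerivAt t h)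

theorem norm_expI_sub_le {C : H →L[ℂ] H} (hC : IsSelfAdjoint C) (t : ℝ) (ξ : H) :
    ‖expI C t ξ - ξ‖ ≤ |t| * ‖C ξ‖ := by
  have h := convex_univ.norm_image_sub_le_of_norm_hasDerivWithin_le
    (f := fun s => expI C s ξ) (C := ‖C ξ‖) (x := 0) (y := t)
    (fun s _ => (hasDerivAt_expI C s ξ).hasDerivWithinAt)
    (fun s _ => by rw [norm_expI hC, norm_smul, Complex.norm_I, one_mul])
    (Set.mem_univ _) (Set.mem_univ _)
  simpa [expI_zero, mul_comm] using h

theorem norm_expI_sub_sub_le {C : H →L[ℂ] H} (hC : IsSelfAdjoint C) (t : ℝ) (ξ ζ : H) :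
    ‖expI C t ξ - ξ - t • (Complex.I • C ξ)‖ ≤ |t| * (2 * ‖C ξ - ζ‖ + |t| * ‖C ζ‖) := by
  have hd : ∀ s : ℝ, HasDerivAt (fun s : ℝ => expI C s ξ - s • (Complex.I • C ξ))
      (expI C s (Complex.I • C ξ) - (1 : ℝ) • (Complex.I • C ξ)) s := fun s =>
    (hasDerivAt_expI C s ξ).sub ((hasDerivAt_id s).smul_const _)
  have hb : ∀ s ∈ Set.Icc (-|t|) |t|,
      ‖expI C s (Complex.I • C ξ) - (1 : ℝ) • (Complex.I • C ξ)‖ ≤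
        2 * ‖C ξ - ζ‖ + |t| * ‖C ζ‖ := by
    intro s hs
    have e : expI C s (Complex.I • C ξ) - (1 : ℝ) • (Complex.I • C ξ) =
        Complex.I • (expI C s (C ξ - ζ) - (C ξ - ζ) + (expI C s ζ - ζ)) := by
      rw [one_smul, map_smul, map_sub, ← smul_sub]; congr 1; abel
    rw [e, norm_smul, Complex.norm_I, one_mul]
    have h1 := norm_sub_le (expI C s (C ξ - ζ)) (C ξ - ζ)
    rw [norm_expI hC] at h1
    have h2 := norm_expI_sub_le hC s ζ
    have h3 : |s| * ‖C ζ‖ ≤ |t| * ‖C ζ‖ := by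
      exact mul_le_mul_of_nonneg_right (abs_le.mpr hs) (norm_nonneg _)
    have h4 := norm_add_le (expI C s (C ξ - ζ) - (C ξ - ζ)) (expI C s ζ - ζ)
    linarith
  have h := (convex_Icc (-|t|) |t|).norm_image_sub_le_of_norm_hasDerivWithin_le
    (f := fun s : ℝ => expI C s ξ - s • (Complex.I • C ξ)) (x := 0) (y := t)
    (fun s _ => (hd s).hasDerivWithinAt) hb (by simp) ⟨neg_abs_le t, le_abs_self t⟩
  rw [expI_zero, zero_smul, sub_zero, sub_zero, Real.norm_eq_abs, one_apply_eq_self,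
    sub_right_comm] at h
  linarith

theorem norm_expI_sub_expI_le {A B : H →L[ℂ] H} (hA : IsSelfAdjoint A) (hB : IsSelfAdjoint B)
    (hAB : Commute A B) (t : ℝ) (ξ : H) :
    ‖expI A t ξ - expI B t ξ‖ ≤ |t| * ‖A ξ - B ξ‖ := by
  let +nondep : NormedAlgebra ℚ (H →L[ℂ] H) := .restrictScalars ℚ ℂ _
  have h : expI A t = expI B t * expI (A - B) t := by
    unfold expI
    rw [← NormedSpace.exp_add_of_commute, ← smul_add, ← smul_add, add_sub_cancel]
    have : Commute B (A - B) := (hAB.symm).sub_right (Commute.refl B)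
    exact (((this.smul_left _).smul_right _).smul_left _).smul_right _
  have h2 : expI A t ξ - expI B t ξ = expI B t (expI (A - B) t ξ - ξ) := by
    rw [h, map_sub]; rfl
  rw [h2, norm_expI hB]
  exact norm_expI_sub_le (hA.sub hB) t ξ

end Bounded

section Yosida

/-- Strong Cauchy convergence of uniformly bounded operators may be checked on a dense set. -/
theorem cauchySeq_of_dense {E : Type*} [NormedAddCommGroup E] [NormedSpace ℂ E]
    {T : ℕ → E →L[ℂ] E} (hT : ∀ n ξ, ‖T n ξ‖ ≤ ‖ξ‖) {S : Set E}
    (hS : Dense S) (h : ∀ ξ ∈ S, CauchySeq fun n => T n ξ) (ξ : E) :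
    CauchySeq fun n => T n ξ := by
  rw [Metric.cauchySeq_iff]
  intro ε hε
  obtain ⟨ζ, hζ, hd⟩ := Metric.mem_closure_iff.mp (hS ξ) (ε / 3) (by positivity)
  obtain ⟨N, hN⟩ := Metric.cauchySeq_iff.mp (h ζ hζ) (ε / 3) (by positivity)
  refine ⟨N, fun m hm n hn => ?_⟩
  have h1 := hN m hm n hn
  rw [dist_eq_norm] at h1 hd ⊢
  have e : T m ξ - T n ξ = T m (ξ - ζ) + (T m ζ - T n ζ) - T n (ξ - ζ) := by
    simp only [map_sub]; abel
  rw [e]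
  have h2 := norm_sub_le (T m (ξ - ζ) + (T m ζ - T n ζ)) (T n (ξ - ζ))
  have h3 := norm_add_le (T m (ξ - ζ)) (T m ζ - T n ζ)
  have h4 := hT m (ξ - ζ)
  have h5 := hT n (ξ - ζ)
  linarith

theorem IsResolventAt.commute {E : Type*} [NormedAddCommGroup E] [InnerProductSpace ℂ E]
    {D : E →ₗ.[ℂ] E} {z w : ℂ} {R S : E →L[ℂ] E} (hR : IsResolventAt D z R)
    (hS : IsResolventAt D w S) : Commute R S := by
  have key : ∀ {z w : ℂ} {R S : E →L[ℂ] E}, IsResolventAt D z R → IsResolventAt D w S →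
      ∀ η, S η - R η = (w - z) • R (S η) := by
    intro z w R S hR hS η
    obtain ⟨x, hx1, hx2⟩ := hS.right_inv η
    have h := hR.left_inv x
    have e : D x - z • (x : E) = η + (w - z) • S η := by
      rw [sub_eq_iff_eq_add.mp hx2, hx1, sub_smul]; abel
    rw [e, map_add, map_smul, hx1] at h
    exact sub_eq_iff_eq_add'.mpr h.symm
  by_cases hzw : z = w
  · subst hzw
    have : R = S := by
      ext η
      have := key hR hS η
      rw [sub_self, zero_smul, sub_eq_zero] at this
      exact this.symm
    rw [this]
  · ext η
    have h1 := key hR hS η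
    have h2 := key hS hR η
    have h3 : (w - z) • R (S η) = (w - z) • S (R η) := by
      rw [← h1, ← neg_sub z w, neg_smul, ← h2]; abel
    exact smul_right_injective _ (sub_ne_zero.mpr (Ne.symm hzw)) h3

theorem IsResolventAt.norm_le (hD : IsSelfAdjoint D) {z : ℂ} {R : H →L[ℂ] H}
    (hR : IsResolventAt D z R) (η : H) : |z.im| * ‖R η‖ ≤ ‖η‖ := by
  obtain ⟨x, hx1, hx2⟩ := hR.right_inv η
  have := im_mul_norm_le hD z x
  rwa [hx2, hx1] at this

theorem IsResolventAt.inner_symm (hD : IsSelfAdjoint D) {z w : ℂ} {R S : H →L[ℂ] H}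
    (hR : IsResolventAt D z R) (hS : IsResolventAt D w S) (hzw : w = starRingEnd ℂ z) (η ζ : H) :
    inner ℂ (R η) ζ = inner ℂ η (S ζ) := by
  obtain ⟨x, hx1, hx2⟩ := hR.right_inv η
  obtain ⟨y, hy1, hy2⟩ := hS.right_inv ζ
  have e1 : inner ℂ (R η) ζ = inner ℂ (x : H) (D y - w • (y : H)) := by rw [hx1, hy2]
  have e2 : inner ℂ η (S ζ) = inner ℂ (D x - z • (x : H)) (y : H) := by rw [hx2, hy1]
  rw [e1, e2, inner_sub_right, inner_sub_left, inner_smul_left, inner_smul_right,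
    inner_symm_of_selfAdjoint hD, hzw]

/-- Self-adjoint operators are approximated by commuting bounded self-adjoint operators. -/
theorem exists_approximation (hD : IsSelfAdjoint D) :
    ∃ B : ℕ → H →L[ℂ] H, (∀ n, IsSelfAdjoint (B n)) ∧ (∀ m n, Commute (B m) (B n)) ∧
      ∀ ξ : D.domain, Tendsto (fun n => B n (ξ : H)) atTop (𝓝 (D ξ)) := by
  let z : ℕ → ℂ := fun n => ((n : ℝ) + 1 : ℝ) * Complex.I
  have hzim : ∀ n, (z n).im = (n : ℝ) + 1 := fun n => by
    simp only [z, Complex.im_ofReal_mul, Complex.I_im, mul_one]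
  have hzconj : ∀ n, starRingEnd ℂ (z n) = - z n := fun n => by
    simp only [z, map_mul, Complex.conj_ofReal, Complex.conj_I, mul_neg]
  have hzpos : ∀ n : ℕ, (0 : ℝ) < (n : ℝ) + 1 := fun n => by positivity
  have hR : ∀ n, ∃ R, IsResolventAt D (z n) R := fun n =>
    exists_isResolventAt hD (by rw [hzim]; exact (hzpos n).ne')
  have hS : ∀ n, ∃ S, IsResolventAt D (- z n) S := fun n =>
    exists_isResolventAt hD (by rw [Complex.neg_im, hzim]; exact (neg_neg_of_pos (hzpos n)).ne)
  choose R hR using hR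
  choose S hS using hS
  have nR : ∀ n η, ‖z n • R n η‖ ≤ ‖η‖ := fun n η => by
    have h := (hR n).norm_le hD η
    have e : ‖z n‖ = |(z n).im| := by
      rw [hzim]; simp only [z, norm_mul, Complex.norm_I, mul_one, Complex.norm_real,
        Real.norm_eq_abs]
    rwa [norm_smul, e]
  have nS : ∀ n η, ‖z n • S n η‖ ≤ ‖η‖ := fun n η => by
    have h := (hS n).norm_le hD η
    have e : ‖z n‖ = |(-z n).im| := by
      rw [Complex.neg_im, abs_neg, hzim]; simp only [z, norm_mul, Complex.norm_I, mul_one,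
        Complex.norm_real, Real.norm_eq_abs]
    rwa [norm_smul, e]
  -- the averaging operators, which converge strongly to the identity
  let J : ℕ → H →L[ℂ] H := fun n => (1 / 2 : ℂ) • (z n • (S n - R n))
  have hJ : ∀ n η, J n η = (1 / 2 : ℂ) • (z n • S n η - z n • R n η) := fun n η => by
    simp [J, smul_sub]
  have nJ : ∀ n η, ‖J n η‖ ≤ ‖η‖ := fun n η => by
    rw [hJ, norm_smul]
    have := norm_sub_le (z n • S n η) (z n • R n η)
    have h1 := nR n η
    have h2 := nS n η
    norm_num
    linarith
  have hRx : ∀ n (x : D.domain), R n (D x) = x + z n • R n x := fun n x => by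
    have := (hR n).left_inv x
    rw [map_sub, map_smul, sub_eq_iff_eq_add] at this
    exact this
  have hSx : ∀ n (x : D.domain), S n (D x) = x - z n • S n x := fun n x => by
    have := (hS n).left_inv x
    rw [map_sub, map_smul, neg_smul, sub_neg_eq_add] at this
    exact eq_sub_iff_add_eq.mpr this
  have hJdom : ∀ n (x : D.domain), ‖J n x - x‖ ≤ (1 / ((n : ℝ) + 1)) * ‖D x‖ := fun n x => by
    have e : J n x - x = (1 / 2 : ℂ) • (- S n (D x) - R n (D x)) := by
      rw [hJ, hRx, hSx]
      have : (x : H) = (1 / 2 : ℂ) • ((x : H) + (x : H)) := by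
        rw [← two_smul ℂ (x : H), smul_smul]; norm_num
      nth_rewrite 3 [this]
      rw [← smul_sub]; congr 1; abel
    have h1 := (hR n).norm_le hD (D x)
    have h2 := (hS n).norm_le hD (D x)
    rw [Complex.neg_im, abs_neg] at h2
    rw [hzim, abs_of_pos (hzpos n), mul_comm, ← le_div_iff₀ (hzpos n)] at h1 h2
    have h3 := norm_sub_le (- S n (D x)) (R n (D x))
    rw [norm_neg] at h3
    rw [e, norm_smul, one_div_mul_eq_div]
    norm_num
    linarith
  have hJlim : ∀ x : D.domain, Tendsto (fun n => J n x) atTop (𝓝 (x : H)) := fun x => by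
    rw [tendsto_iff_norm_sub_tendsto_zero]
    refine squeeze_zero (fun n => norm_nonneg _) (fun n => hJdom n x) ?_
    simpa using (tendsto_one_div_add_atTop_nhds_zero_nat (𝕜 := ℝ)).mul_const ‖D x‖
  have hJall : ∀ η : H, Tendsto (fun n => J n η) atTop (𝓝 η) := fun η => by
    rw [Metric.tendsto_atTop]
    intro ε hε
    obtain ⟨ζ, hζ, hd⟩ := Metric.mem_closure_iff.mp (hD.dense_domain η) (ε / 3) (by positivity)
    obtain ⟨N, hN⟩ := Metric.tendsto_atTop.mp (hJlim ⟨ζ, hζ⟩) (ε / 3) (by positivity)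
    refine ⟨N, fun n hn => ?_⟩
    have h1 := hN n hn
    rw [dist_eq_norm] at h1 hd ⊢
    have e : J n η - η = J n (η - ζ) + (J n ζ - ζ) - (η - ζ) := by rw [map_sub]; abel
    rw [e]
    have h2 := norm_sub_le (J n (η - ζ) + (J n ζ - ζ)) (η - ζ)
    have h3 := norm_add_le (J n (η - ζ)) (J n ζ - ζ)
    have h4 := nJ n (η - ζ)
    simp only at h1
    linarith
  let c : ℕ → ℝ := fun n => ((n : ℝ) + 1) ^ 2 / 2
  let B : ℕ → H →L[ℂ] H := fun n => (c n : ℂ) • (R n + S n)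
  have hBJ : ∀ n (x : D.domain), B n x = J n (D x) := fun n x => by
    have hz2 : z n * z n = -(((n : ℝ) + 1) ^ 2 : ℝ) := by
      simp only [z]
      rw [mul_mul_mul_comm, Complex.I_mul_I]; push_cast; ring
    rw [hJ, hRx, hSx]
    have : z n • ((x : H) - z n • S n x) - z n • ((x : H) + z n • R n x) =
        -(z n * z n) • (R n x + S n x) := by
      rw [smul_sub, smul_add, smul_smul, smul_smul, neg_smul, smul_add]; abel
    rw [this, smul_smul, hz2, neg_neg]
    simp only [B, c, smul_apply, add_apply]
    congr 1
    push_cast; ring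
  refine ⟨B, fun n => ?_, fun m n => ?_, fun ξ => ?_⟩
  · rw [ContinuousLinearMap.isSelfAdjoint_iff_isSymmetric]
    intro η ζ
    have h1 := (hR n).inner_symm hD (hS n) (hzconj n).symm η ζ
    have h2 := (hS n).inner_symm hD (hR n) (by rw [map_neg, hzconj, neg_neg]) η ζ
    simp only [B, ContinuousLinearMap.coe_coe, smul_apply,
      add_apply, inner_smul_left, inner_smul_right, inner_add_left,
      inner_add_right, h1, h2, Complex.conj_ofReal]
    ring
  · have h : Commute (R m + S m) (R n + S n) :=
      (((hR m).commute (hR n)).add_right ((hR m).commute (hS n))).add_left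
        (((hS m).commute (hR n)).add_right ((hS m).commute (hS n)))
    exact (h.smul_left _).smul_right _
  · simp only [hBJ]
    exact hJall (D ξ)

/-- Existence half of Stone's theorem. -/
theorem exists_isUnitaryGroupOf (hD : IsSelfAdjoint D) :
    ∃ U : ℝ → H →L[ℂ] H, IsUnitaryGroupOf D U := by
  obtain ⟨B, hB, hBc, hBlim⟩ := exists_approximation hD
  have hcau : ∀ t ξ, CauchySeq fun n => expI (B n) t ξ := by
    intro t
    refine cauchySeq_of_dense (fun n ξ => (norm_expI (hB n) t ξ).le) hD.dense_domain ?_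
    intro ξ hξ
    rw [Metric.cauchySeq_iff]
    intro ε hε
    obtain ⟨N, hN⟩ := Metric.cauchySeq_iff.mp (hBlim ⟨ξ, hξ⟩).cauchySeq (ε / (|t| + 1))
      (by positivity)
    refine ⟨N, fun m hm n hn => ?_⟩
    have h1 := hN m hm n hn
    rw [dist_eq_norm, lt_div_iff₀ (by positivity)] at h1
    rw [dist_eq_norm]
    have h2 := norm_expI_sub_expI_le (hB m) (hB n) (hBc m n) t ξ
    have h3 := norm_nonneg (B m ξ - B n ξ)
    simp only at h1
    nlinarith
  choose u hu using fun t ξ => cauchySeq_tendsto_of_complete (hcau t ξ)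
  let U : ℝ → H →L[ℂ] H := fun t =>
    continuousLinearMapOfTendsto (fun n => expI (B n) t) (f := u t)
      (tendsto_pi_nhds.mpr fun ξ => hu t ξ)
  have hU : ∀ t ξ, Tendsto (fun n => expI (B n) t ξ) atTop (𝓝 (U t ξ)) := hu
  have hnorm : ∀ t ξ, ‖U t ξ‖ = ‖ξ‖ := fun t ξ =>
    tendsto_nhds_unique (hU t ξ).norm
      (by simp only [norm_expI (hB _)]; exact tendsto_const_nhds)
  have hzero : U 0 = 1 := by
    ext ξ
    refine tendsto_nhds_unique (hU 0 ξ) ?_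
    simp only [expI_zero]
    exact tendsto_const_nhds
  have hadd : ∀ s t, U (s + t) = U s * U t := by
    intro s t
    ext ξ
    refine tendsto_nhds_unique (hU (s + t) ξ) ?_
    simp only [expI_add, mul_apply_eq_comp]
    have h1 := hU s (U t ξ)
    have h2 : Tendsto (fun n => expI (B n) s (expI (B n) t ξ) - expI (B n) s (U t ξ)) atTop
        (𝓝 0) := by
      rw [tendsto_zero_iff_norm_tendsto_zero]
      simp only [← map_sub, norm_expI (hB _)]
      exact (tendsto_iff_norm_sub_tendsto_zero).mp (hU t ξ)
    simpa using h2.add h1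
  have hunit : ∀ t, U t ∈ unitary (H →L[ℂ] H) := by
    intro t
    have h1 : star (U t) * U t = 1 :=
      (ContinuousLinearMap.norm_map_iff_adjoint_comp_self (U t)).mp (hnorm t)
    have h2 : U t * U (-t) = 1 := by rw [← hadd, add_neg_cancel, hzero]
    have h3 : star (U t) = U (-t) := left_inv_eq_right_inv h1 h2
    exact Unitary.mem_iff.mpr ⟨h1, by rw [h3, h2]⟩
  have hlip : ∀ t (ξ : D.domain), ‖U t ξ - ξ‖ ≤ |t| * ‖D ξ‖ := fun t ξ =>
    le_of_tendsto_of_tendsto' ((hU t ξ).sub_const _).norm ((hBlim ξ).norm.const_mul |t|)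
      fun n => norm_expI_sub_le (hB n) t ξ
  refine ⟨U, hzero, hadd, hunit, fun ξ => ?_, fun ξ => ?_⟩
  · have hdiff : ∀ s t η, ‖U t η - U s η‖ = ‖U (t - s) η - η‖ := fun s t η => by
      have : U t η - U s η = U s (U (t - s) η - η) := by
        rw [map_sub, ← mul_apply_eq_comp, ← hadd, add_sub_cancel]
      rw [this, hnorm]
    rw [Metric.continuous_iff]
    intro s ε hε
    obtain ⟨ζ, hζ, hd⟩ := Metric.mem_closure_iff.mp (hD.dense_domain ξ) (ε / 3) (by positivity)
    refine ⟨(ε / 3) / (‖D ⟨ζ, hζ⟩‖ + 1), by positivity, fun t ht => ?_⟩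
    rw [dist_eq_norm] at hd ⊢
    rw [Real.dist_eq, lt_div_iff₀ (by positivity)] at ht
    rw [hdiff]
    have e : U (t - s) ξ - ξ = U (t - s) (ξ - ζ) + (U (t - s) ζ - ζ) - (ξ - ζ) := by
      rw [map_sub]; abel
    rw [e]
    have h2 := norm_sub_le (U (t - s) (ξ - ζ) + (U (t - s) ζ - ζ)) (ξ - ζ)
    have h3 := norm_add_le (U (t - s) (ξ - ζ)) (U (t - s) ζ - ζ)
    rw [hnorm] at h3
    have h4 := hlip (t - s) ⟨ζ, hζ⟩
    have h5 := abs_nonneg (t - s)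
    simp only at h4
    nlinarith
  · have hest : ∀ t (ζ : D.domain), ‖U t ξ - ξ - t • (Complex.I • D ξ)‖ ≤
        |t| * (2 * ‖D ξ - ζ‖ + |t| * ‖D ζ‖) := fun t ζ =>
      le_of_tendsto_of_tendsto'
        (((hU t ξ).sub_const _).sub (((hBlim ξ).const_smul Complex.I).const_smul t)).norm
        (((((hBlim ξ).sub_const (ζ : H)).norm.const_mul 2).add
          ((hBlim ζ).norm.const_mul |t|)).const_mul |t|)
        fun n => norm_expI_sub_sub_le (hB n) t ξ ζ
    rw [hasDerivAt_iff_isLittleO_nhds_zero, Asymptotics.isLittleO_iff]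
    intro ε hε
    obtain ⟨ζ, hζ, hd⟩ := Metric.mem_closure_iff.mp (hD.dense_domain (D ξ)) (ε / 4)
      (by positivity)
    rw [dist_eq_norm] at hd
    refine Metric.eventually_nhds_iff.mpr ⟨(ε / 2) / (‖D ⟨ζ, hζ⟩‖ + 1), by positivity,
      fun t ht => ?_⟩
    rw [Real.dist_eq, sub_zero, lt_div_iff₀ (by positivity)] at ht
    have h := hest t ⟨ζ, hζ⟩
    rw [zero_add, hzero, one_apply_eq_self, Real.norm_eq_abs]
    refine h.trans ?_
    rw [mul_comm]
    have h5 := abs_nonneg t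
    have h6 := norm_nonneg (D ⟨ζ, hζ⟩)
    gcongr
    simp only
    nlinarith

end Yosida

end UnboundedOperators
/-! ### Quantum compact metric spaces -/

/-- The state space of a unital C*-algebra, a subset of the dual with the weak* topology. -/
def StateSpace (A : Type*) [CStarAlgebra A] : Set (WeakDual ℂ A) :=
  {φ | φ 1 = 1 ∧ ∀ a : A, 0 ≤ φ (star a * a)}

/-- `sup_{x ∈ S} inf_{y ∈ T} d x y`. -/
noncomputable def hausdorffFrom {X : Type*} (d : X → X → ℝ≥0∞) (S T : Set X) : ℝ≥0∞ :=
  ⨆ x ∈ S, ⨅ y ∈ T, d x y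

/-- The Hausdorff distance between `S` and `T` for the distance function `d`. -/
noncomputable def hausdorffDistance {X : Type*} (d : X → X → ℝ≥0∞) (S T : Set X) : ℝ≥0∞ :=
  max (hausdorffFrom d S T) (hausdorffFrom d T S)

/-- The Monge-Kantorovich distance. Partially defined seminorms are extended by `∞`. -/
noncomputable def mongeKantorovich {A : Type*} [CStarAlgebra A] (L : selfAdjoint A → ℝ≥0∞)
    (φ ψ : WeakDual ℂ A) : ℝ≥0∞ :=
  ⨆ (a : selfAdjoint A) (_ : L a ≤ 1), ‖φ (a : A) - ψ (a : A)‖ₑ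

/-- `(A, L)` is an `(F, K)`-quantum compact metric space. The domain of the seminorm `L` is
`{a | L a < ∞}`. -/
structure IsQuantumMetric (F K : ℝ≥0) {A : Type*} [CStarAlgebra A]
    (L : selfAdjoint A → ℝ≥0∞) : Prop where
  add_le : ∀ a b, L (a + b) ≤ L a + L b
  smul : ∀ (r : ℝ) (a), L (r • a) = ‖r‖ₑ * L a
  dense : Dense {a | L a < ∞}
  one : L 1 = 0
  metric : ∃ m : MetricSpace (StateSpace A),
    (∀ φ ψ : StateSpace A,
      mongeKantorovich L (φ : WeakDual ℂ A) (ψ : WeakDual ℂ A) = ENNReal.ofReal (m.dist φ ψ)) ∧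
    m.toUniformSpace.toTopologicalSpace = instTopologicalSpaceSubtype
  leibniz : ∀ a b : selfAdjoint A, L a < ∞ → L b < ∞ →
    max (L (ℜ ((a : A) * (b : A)))) (L (ℑ ((a : A) * (b : A)))) ≤
      F * (L a * ‖(b : A)‖ₑ + ‖(a : A)‖ₑ * L b) + K * L a * L b
  isClosed : IsClosed {a | L a ≤ 1}

/-! ### Metrical C*-correspondences -/

/-- An `A`-`B`-C*-correspondence: a right Hilbert `B`-module `M`, with `B`-valued inner product
`ip`, linear in its second variable, and a unital *-morphism `act` from `A` to the adjointable
operators of `M`. The right action of `b` is written `MulOpposite.op b • ω`, and an element of `B`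
is positive when it is of the form `star c * c`. -/
structure CStarCorrespondence where
  A : Type u
  M : Type v
  B : Type w
  [algA : CStarAlgebra A]
  [algB : CStarAlgebra B]
  [normedGroup : NormedAddCommGroup M]
  [normedSpace : NormedSpace ℂ M]
  [complete : CompleteSpace M]
  [rightModule : Module (MulOpposite B) M]
  ip : M → M → B
  ip_add : ∀ ω η ζ, ip ω (η + ζ) = ip ω η + ip ω ζ
  ip_smul : ∀ (c : ℂ) (ω η), ip ω (c • η) = c • ip ω η
  ip_op_smul : ∀ (b : B) (ω η), ip ω (MulOpposite.op b • η) = ip ω η * b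
  star_ip : ∀ ω η, star (ip η ω) = ip ω η
  ip_self_nonneg : ∀ ω, ∃ c : B, ip ω ω = star c * c
  ip_self_eq_zero : ∀ ω, ip ω ω = 0 ↔ ω = 0
  norm_eq : ∀ ω : M, ‖ω‖ = √‖ip ω ω‖
  act : A →ₐ[ℂ] (M →L[ℂ] M)
  ip_act : ∀ (a : A) (ω η), ip (act a ω) η = ip ω (act (star a) η)

attribute [instance] CStarCorrespondence.algA CStarCorrespondence.algB
  CStarCorrespondence.normedGroup CStarCorrespondence.normedSpace CStarCorrespondence.complete
  CStarCorrespondence.rightModule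

/-- A C*-correspondence together with a (candidate) D-norm `DN` on the module and (candidate)
L-seminorms `LA`, `LB` on the two C*-algebras, all extended by `∞` outside of their domains. -/
structure QuantumCorrespondence extends CStarCorrespondence.{u, v, w} where
  DN : M → ℝ≥0∞
  LA : selfAdjoint A → ℝ≥0∞
  LB : selfAdjoint B → ℝ≥0∞

/-- `X` is an `(F, K, G, H)`-metrical C*-correspondence. -/
structure QuantumCorrespondence.IsMetrical (F K G H : ℝ≥0)
    (X : QuantumCorrespondence.{u, v, w}) : Prop where
  quantumA : IsQuantumMetric F K X.LA
  quantumB : IsQuantumMetric F K X.LB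
  add_le : ∀ ω η, X.DN (ω + η) ≤ X.DN ω + X.DN η
  smul : ∀ (c : ℂ) (ω), X.DN (c • ω) = ‖c‖ₑ * X.DN ω
  dense : Dense {ω | X.DN ω < ∞}
  norm_le : ∀ ω, ‖ω‖ₑ ≤ X.DN ω
  isCompact : IsCompact {ω | X.DN ω ≤ 1}
  modular_leibniz : ∀ (a : selfAdjoint X.A) (ω), X.LA a < ∞ → X.DN ω < ∞ →
    X.DN (X.act a ω) ≤ G * (‖(a : X.A)‖ₑ + X.LA a) * X.DN ω
  inner_leibniz : ∀ ω η, X.DN ω < ∞ → X.DN η < ∞ →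
    max (X.LB (ℜ (X.ip ω η))) (X.LB (ℑ (X.ip ω η))) ≤ H * X.DN ω * X.DN η

/-- The action of a *-morphism on self-adjoint elements. -/
def mapSelfAdjoint {A B : Type*} [CStarAlgebra A] [CStarAlgebra B] (π : A →⋆ₐ[ℂ] B)
    (a : selfAdjoint A) : selfAdjoint B :=
  ⟨π a, IsSelfAdjoint.map a.2 π⟩

/-- Lipschitz morphisms of metrical C*-correspondences. -/
structure LipschitzMorphism (X Y : QuantumCorrespondence.{u, v, w}) where
  onM : X.M →L[ℂ] Y.M
  onA : X.A →⋆ₐ[ℂ] Y.A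
  onB : X.B →⋆ₐ[ℂ] Y.B
  map_act : ∀ (a : X.A) (ω : X.M), onM (X.act a ω) = Y.act (onA a) (onM ω)
  map_op_smul : ∀ (b : X.B) (ω : X.M),
    onM (MulOpposite.op b • ω) = MulOpposite.op (onB b) • onM ω
  map_ip : ∀ ω η : X.M, onB (X.ip ω η) = Y.ip (onM ω) (onM η)
  domA : ∀ a, X.LA a < ∞ → Y.LA (mapSelfAdjoint onA a) < ∞
  domB : ∀ b, X.LB b < ∞ → Y.LB (mapSelfAdjoint onB b) < ∞
  domM : ∀ ω, X.DN ω < ∞ → Y.DN (onM ω) < ∞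

/-- Modular quantum isometries: the D-norm and the L-seminorms of the codomain are the quotients of
those of the domain. -/
structure ModularQuantumIsometry (X Y : QuantumCorrespondence.{u, v, w}) extends
    LipschitzMorphism X Y where
  quotientA : ∀ a, Y.LA a < ∞ →
    Y.LA a = ⨅ (d : selfAdjoint X.A) (_ : mapSelfAdjoint onA d = a), X.LA d
  quotientB : ∀ b, Y.LB b < ∞ →
    Y.LB b = ⨅ (d : selfAdjoint X.B) (_ : mapSelfAdjoint onB d = b), X.LB d
  quotientM : ∀ ω, Y.DN ω < ∞ → Y.DN ω = ⨅ (η : X.M) (_ : onM η = ω), X.DN η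

/-- Metrical tunnels, through `(F, K, G, H)`-metrical C*-correspondences. -/
structure Tunnel (F K G H : ℝ≥0) (X Y : QuantumCorrespondence.{u, v, w}) where
  P : QuantumCorrespondence.{u, v, w}
  isMetrical : P.IsMetrical F K G H
  left : ModularQuantumIsometry P X
  right : ModularQuantumIsometry P Y

namespace Tunnel

variable {F K G H : ℝ≥0} {X Y : QuantumCorrespondence.{u, v, w}}

/-- The reversed tunnel. -/
def symm (τ : Tunnel F K G H X Y) : Tunnel F K G H Y X :=
  ⟨τ.P, τ.isMetrical, τ.right, τ.left⟩

/-- The set `{φ ∘ π : φ ∈ S(B)}` of functionals on `A`. -/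
def pullbackStates {A B : Type*} [CStarAlgebra A] [CStarAlgebra B] (π : A →⋆ₐ[ℂ] B) :
    Set (WeakDual ℂ A) :=
  {χ | ∃ φ ∈ StateSpace B, ∀ a, χ a = φ (π a)}

/-- The extent of a metrical tunnel. -/
noncomputable def extent (τ : Tunnel F K G H X Y) : ℝ≥0∞ :=
  max
    (max
      (hausdorffDistance (mongeKantorovich τ.P.LA) (pullbackStates τ.left.onA) (StateSpace τ.P.A))
      (hausdorffDistance (mongeKantorovich τ.P.LB) (pullbackStates τ.left.onB) (StateSpace τ.P.B)))
    (max
      (hausdorffDistance (mongeKantorovich τ.P.LA) (pullbackStates τ.right.onA) (StateSpace τ.P.A))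
      (hausdorffDistance (mongeKantorovich τ.P.LB) (pullbackStates τ.right.onB)
        (StateSpace τ.P.B)))

end Tunnel

/-! ### The operational propinquity -/

/-- The Monge-Kantorovich distance between families of functionals on the module. -/
noncomputable def kantorovichFamily (X : QuantumCorrespondence.{u, v, w}) {J : Type*}
    (Φ Ψ : J → X.M →L[ℂ] ℂ) : ℝ≥0∞ :=
  ⨆ (j : J) (ω : X.M) (_ : X.DN ω ≤ 1), ‖Φ j ω - Ψ j ω‖ₑ

/-- The pseudo-states `μ(⟨ω, ·⟩)`, where `μ` is a state of `B` and `DN ω ≤ 1`. -/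
def pseudoStates (X : QuantumCorrespondence.{u, v, w}) : Set (X.M →L[ℂ] ℂ) :=
  {φ | ∃ μ ∈ StateSpace X.B, ∃ ω : X.M, X.DN ω ≤ 1 ∧ ∀ ξ, φ ξ = μ (X.ip ω ξ)}

/-- The adjointable operators of the Hilbert module of a C*-correspondence. -/
def Adjointable (X : CStarCorrespondence.{u, v, w}) : Set (X.M →L[ℂ] X.M) :=
  {T | ∃ S : X.M →L[ℂ] X.M, ∀ ω η, X.ip (T ω) η = X.ip ω (S η)}

section Operational

variable {F K G H : ℝ≥0} {X Y : QuantumCorrespondence.{u, v, w}} {J : Type*}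

/-- The separation of two families of adjointable operators according to a tunnel. -/
noncomputable def Tunnel.separation (τ : Tunnel F K G H X Y)
    (a : J → Adjointable X.toCStarCorrespondence)
    (b : J → Adjointable Y.toCStarCorrespondence) : ℝ≥0∞ :=
  hausdorffDistance (kantorovichFamily τ.P)
    {Φ | ∃ φ ∈ pseudoStates X, Φ = fun j => φ.comp ((a j : X.M →L[ℂ] X.M).comp τ.left.onM)}
    {Ψ | ∃ ψ ∈ pseudoStates Y, Ψ = fun j => ψ.comp ((b j : Y.M →L[ℂ] Y.M).comp τ.right.onM)}

/-- The dispersion of two families of adjointable operators according to a tunnel. -/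
noncomputable def Tunnel.dispersion (τ : Tunnel F K G H X Y)
    (a : J → Adjointable X.toCStarCorrespondence)
    (b : J → Adjointable Y.toCStarCorrespondence) : ℝ≥0∞ :=
  max τ.extent (τ.separation a b)

variable (F K G H) in
/-- The operational propinquity between two families of adjointable operators. -/
noncomputable def operationalPropinquity (a : J → Adjointable X.toCStarCorrespondence)
    (b : J → Adjointable Y.toCStarCorrespondence) : ℝ≥0∞ :=
  ⨅ τ : Tunnel F K G H X Y, τ.dispersion a b

end Operational

/-! ### Metric spectral triples -/

section Operators

variable {H : Type*} [NormedAddCommGroup H] [InnerProductSpace ℂ H]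

/-- The operator norm of `[D, T]` if `T` maps the domain of `D` to itself (it is `∞` when `[D, T]`
is unbounded), and `∞` otherwise. -/
noncomputable def commutatorNorm (D : H →ₗ.[ℂ] H) (T : H →L[ℂ] H) : ℝ≥0∞ :=
  ⨅ h : ∀ ξ : D.domain, T ξ ∈ D.domain,
    ⨆ (ξ : D.domain) (_ : ‖(ξ : H)‖ ≤ 1), ‖D ⟨T ξ, h ξ⟩ - T (D ξ)‖ₑ

/-- The graph norm `‖ξ‖ + ‖D ξ‖`, extended by `∞` outside of the domain of `D`. -/
noncomputable def graphNorm (D : H →ₗ.[ℂ] H) (ξ : H) : ℝ≥0∞ :=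
  ⨅ h : ξ ∈ D.domain, ‖ξ‖ₑ + ‖D ⟨ξ, h⟩‖ₑ

end Operators

/-- Spectral triples. -/
structure SpectralTriple where
  A : Type u
  H : Type v
  [alg : CStarAlgebra A]
  [normedGroup : NormedAddCommGroup H]
  [innerProduct : InnerProductSpace ℂ H]
  [complete : CompleteSpace H]
  rep : A →⋆ₐ[ℂ] (H →L[ℂ] H)
  D : H →ₗ.[ℂ] H
  selfAdjoint_D : IsSelfAdjoint D
  compact_resolvent : ∃ R : H →L[ℂ] H, IsResolventAt D (-Complex.I) R ∧ IsCompactOperator R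
  dense : Dense {a : selfAdjoint A | commutatorNorm D (rep a) < ∞}

attribute [instance] SpectralTriple.alg SpectralTriple.normedGroup SpectralTriple.innerProduct
  SpectralTriple.complete

namespace SpectralTriple

/-- The seminorm `a ↦ ‖[D, a]‖`. -/
noncomputable def lip (T : SpectralTriple.{u, v}) (a : selfAdjoint T.A) : ℝ≥0∞ :=
  commutatorNorm T.D (T.rep a)

/-- A spectral triple is metric when `(A, ‖[D, ·]‖)` is a quantum compact metric space (the
`(1, 0)`-Leibniz inequality is the usual Leibniz inequality of commutators). -/
def IsMetric (T : SpectralTriple.{u, v}) : Prop :=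
  IsQuantumMetric 1 0 T.lip

/-- The correspondence `(H, graph norm of D, A, ‖[D, ·]‖, ℂ, 0)` of a spectral triple. -/
@[reducible]
noncomputable def toCorrespondence (T : SpectralTriple.{u, v}) :
    QuantumCorrespondence.{u, v, 0} where
  A := T.A
  M := T.H
  B := ℂ
  rightModule := Module.compHom T.H ((RingEquiv.toOpposite ℂ).symm : MulOpposite ℂ →+* ℂ)
  ip := fun ξ η => inner ℂ ξ η
  ip_add := inner_add_right
  ip_smul := fun c ξ η => inner_smul_right ξ η c
  ip_op_smul := fun b ξ η => (inner_smul_right ξ η b).trans (mul_comm _ _)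
  star_ip := fun ξ η => inner_conj_symm ξ η
  ip_self_nonneg := fun ξ => ⟨(‖ξ‖ : ℂ), by
    rw [inner_self_eq_norm_sq_to_K, sq]; simp⟩
  ip_self_eq_zero := fun ξ => inner_self_eq_zero
  norm_eq := fun ξ => by
    rw [inner_self_eq_norm_sq_to_K, norm_pow]; simp
  act := T.rep.toAlgHom
  ip_act := fun a ξ η => by
    have h : T.rep (star a) = ContinuousLinearMap.adjoint (T.rep a) := map_star T.rep a
    change inner ℂ (T.rep a ξ) η = inner ℂ ξ (T.rep (star a) η)
    rw [h, ContinuousLinearMap.adjoint_inner_right]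
  DN := graphNorm T.D
  LA := T.lip
  LB := fun _ => 0

/-- All bounded operators on a Hilbert space are adjointable. -/
theorem mem_adjointable (T : SpectralTriple.{u, v}) (S : T.H →L[ℂ] T.H) :
    S ∈ Adjointable T.toCorrespondence.toCStarCorrespondence :=
  ⟨ContinuousLinearMap.adjoint S, fun ξ η =>
    (ContinuousLinearMap.adjoint_inner_right S ξ η).symm⟩

/-- The unitary group `t ↦ exp (i t D)`. -/
noncomputable def unitaryGroup (T : SpectralTriple.{u, v}) : ℝ → T.H →L[ℂ] T.H :=
  (exists_isUnitaryGroupOf T.selfAdjoint_D).choose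

theorem isUnitaryGroupOf_unitaryGroup (T : SpectralTriple.{u, v}) :
    IsUnitaryGroupOf T.D T.unitaryGroup :=
  (exists_isUnitaryGroupOf T.selfAdjoint_D).choose_spec

/-- The resolvent `(D - z)⁻¹` for `z` in `ℂ \ ℝ`. -/
noncomputable def resolvent (T : SpectralTriple.{u, v}) (z : ℂ) (hz : z.im ≠ 0) :
    T.H →L[ℂ] T.H :=
  (exists_isResolventAt T.selfAdjoint_D hz).choose

theorem isResolventAt_resolvent (T : SpectralTriple.{u, v}) (z : ℂ) (hz : z.im ≠ 0) :
    IsResolventAt T.D z (T.resolvent z hz) :=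
  (exists_isResolventAt T.selfAdjoint_D hz).choose_spec

end SpectralTriple

/-! ### The spectral propinquity -/

/-- `ε`-iso-isos of `[0, ∞)`. -/
def IsIsoIso (ε : ℝ) (ς₁ ς₂ : ℝ≥0 → ℝ≥0) : Prop :=
  ς₁ 0 = 0 ∧ ς₂ 0 = 0 ∧
    ∀ x y z : ℝ≥0, (x : ℝ) ≤ 1 / ε → (y : ℝ) ≤ 1 / ε → (z : ℝ) ≤ 1 / ε →
      abs (abs ((ς₁ x : ℝ) + ς₁ y - z) - abs ((x : ℝ) + y - ς₂ z)) < ε ∧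
      abs (abs ((ς₂ x : ℝ) + ς₂ y - z) - abs ((x : ℝ) + y - ς₁ z)) < ε

section Spectral

variable {F K G H : ℝ≥0} {T₁ T₂ : SpectralTriple.{u, v}}

/-- The one-sided reach: how far the orbits `(⟨U₁ (-t) ξ, Π₁ ·⟩)` are from the set of all the
orbits `(⟨U₂ (-ς t) η, Π₂ ·⟩)`, for `0 ≤ t ≤ 1 / ε`, where `ξ`, `η` are in the closed unit balls of
the graph norms. -/
noncomputable def halfReach (τ : Tunnel F K G H T₁.toCorrespondence T₂.toCorrespondence)
    (ς : ℝ≥0 → ℝ≥0) (ε : ℝ) : ℝ≥0∞ :=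
  hausdorffFrom (kantorovichFamily τ.P)
    {Φ : {t : ℝ≥0 // (t : ℝ) ≤ 1 / ε} → τ.P.M →L[ℂ] ℂ | ∃ ξ : T₁.H, graphNorm T₁.D ξ ≤ 1 ∧
      Φ = fun t => (innerSL ℂ (T₁.unitaryGroup (-(t.1 : ℝ)) ξ)).comp τ.left.onM}
    {Ψ : {t : ℝ≥0 // (t : ℝ) ≤ 1 / ε} → τ.P.M →L[ℂ] ℂ | ∃ η : T₂.H, graphNorm T₂.D η ≤ 1 ∧
      Ψ = fun t => (innerSL ℂ (T₂.unitaryGroup (-(ς t.1 : ℝ)) η)).comp τ.right.onM}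

/-- The `ε`-magnitude: the maximum of the extent and of the `ε`-reach. -/
noncomputable def magnitude (τ : Tunnel F K G H T₁.toCorrespondence T₂.toCorrespondence)
    (ς₁ ς₂ : ℝ≥0 → ℝ≥0) (ε : ℝ) : ℝ≥0∞ :=
  max τ.extent (max (halfReach τ ς₁ ε) (halfReach τ.symm ς₂ ε))

variable (F K G H) in
/-- The spectral propinquity between two (metric) spectral triples. -/
noncomputable def spectralPropinquity (T₁ T₂ : SpectralTriple.{u, v}) : ℝ :=
  sInf (insert (√2 / 2) {ε : ℝ | 0 < ε ∧
    ∃ (τ : Tunnel F K G H T₁.toCorrespondence T₂.toCorrespondence) (ς₁ ς₂ : ℝ≥0 → ℝ≥0),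
      IsIsoIso ε ς₁ ς₂ ∧ magnitude τ ς₁ ς₂ ε < ENNReal.ofReal ε})

end Spectral

end SpectralPropinquity

namespace SpectralPropinquity

open scoped ENNReal NNReal ComplexStarModule ComplexOrder
open Filter Topology

/-! ### The unitary group of a self-adjoint operator preserves its graph norm -/

/-! The resolvent is a Laplace transform of the unitary group. With `R` the inverse of `D - conj z`
and `U t = exp (i t D)`, for `Im z > 0` one has `⟨R ξ, a⟩ = i ∫₀^∞ e^{izt} ⟨U t ξ, a⟩ dt`; for `Im z
< 0` it is `-i` times the same integral over `(-∞, 0]`. The weight `e^{izt}` decays exponentially,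
so up to an error of order `e^{-S|Im z|}` the resolvent depends only on the orbit over times `|t| ≤
S`, which is what the spectral propinquity controls once `2 S ≤ 1 / ε`.

Instead of an integral, `norm_inner_resolvent_sub_le` applies the mean value inequality to `t ↦
e^{izt} ⟨U t (R ξ), a⟩`, whose derivative is `-i e^{izt} ⟨U t ξ, a⟩`. Orbits that are `C`-close on
`[-S, S]` then have resolvents that are close up to `C S + 2 e^{-S|Im z|} / |Im z|`.

The orbits come from `exists_orbit_of_halfReach_lt`. The reach compares time `-t` with time `-ς t`,
for `t ≥ 0` only. An iso-iso moves times by less than `ε` and orbits of vectors of graph norm at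
most 1 are 1-Lipschitz, so `ς t` may be replaced by `t`; since the group preserves the graph norm, a
time shift by `S` reaches both signs of time. This gives `C = 2 ε`.

Pseudo-states of a spectral triple are the functionals `⟨ξ, ·⟩`, so the bound on resolvents is a
bound on the separation along the same tunnel, whose extent is already below `ε`. Fixing `S` for the
tail first and then letting `ε` go to 0 concludes. -/

theorem graphNorm_le_one_iff {H : Type*} [NormedAddCommGroup H] [InnerProductSpace ℂ H]
    {D : H →ₗ.[ℂ] H} {ξ : H} :
    graphNorm D ξ ≤ 1 ↔ ∃ h : ξ ∈ D.domain, ‖ξ‖ + ‖D ⟨ξ, h⟩‖ ≤ 1 := by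
  have e : ∀ h : ξ ∈ D.domain, ‖ξ‖ₑ + ‖D ⟨ξ, h⟩‖ₑ ≤ 1 ↔ ‖ξ‖ + ‖D ⟨ξ, h⟩‖ ≤ 1 := fun h => by
    rw [← ofReal_norm, ← ofReal_norm, ← ENNReal.ofReal_add (norm_nonneg _) (norm_nonneg _),
      ENNReal.ofReal_le_one]
  by_cases h : ξ ∈ D.domain
  · simp only [graphNorm, h, iInf_pos, exists_true_left, e]
  · simp [graphNorm, h]

section UnitaryGroup

variable {H : Type*} [NormedAddCommGroup H] [InnerProductSpace ℂ H] [CompleteSpace H]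
  {D : H →ₗ.[ℂ] H} {U : ℝ → H →L[ℂ] H}

theorem IsUnitaryGroupOf.norm_apply (hU : IsUnitaryGroupOf D U) (t : ℝ) (ξ : H) :
    ‖U t ξ‖ = ‖ξ‖ :=
  ContinuousLinearMap.norm_map_of_mem_unitary (hU.unitary t) ξ

theorem IsUnitaryGroupOf.apply_add (hU : IsUnitaryGroupOf D U) (s t : ℝ) (ξ : H) :
    U (s + t) ξ = U s (U t ξ) := by
  rw [hU.add]; rfl

/-- The group law `U s = U t U (s - t)` transports the derivative from time 0 to time `t`. -/
theorem IsUnitaryGroupOf.hasDerivAt_apply (hU : IsUnitaryGroupOf D U) (ξ : D.domain) (t : ℝ) :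
    HasDerivAt (fun s => U s (ξ : H)) (U t (Complex.I • D ξ)) t := by
  -- The base point 0 is written `t - t` to match the composition with `s ↦ s - t`.
  have h0 : HasDerivAt (fun s => U s (ξ : H)) (Complex.I • D ξ) (t - t) := by
    rw [sub_self]; exact hU.hasDerivAt ξ
  have h1 := h0.scomp (h := fun s => s - t) t ((hasDerivAt_id' t).sub_const t)
  rw [one_smul] at h1
  have h2 := (((U t).restrictScalars ℝ).hasFDerivAt).comp_hasDerivAt t h1
  refine h2.congr_of_eventuallyEq (Eventually.of_forall fun s => ?_)
  change U s (ξ : H) = U t (U (s - t) ξ)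
  rw [← hU.apply_add, add_sub_cancel]

theorem IsUnitaryGroupOf.norm_sub_le (hU : IsUnitaryGroupOf D U) (ξ : D.domain) (s t : ℝ) :
    ‖U s (ξ : H) - U t ξ‖ ≤ |s - t| * ‖D ξ‖ := by
  have h := convex_univ.norm_image_sub_le_of_norm_hasDerivWithin_le
    (f := fun r => U r (ξ : H)) (C := ‖D ξ‖) (x := t) (y := s)
    (fun r _ => (hU.hasDerivAt_apply ξ r).hasDerivWithinAt)
    (fun r _ => by rw [hU.norm_apply, norm_smul, Complex.norm_I, one_mul])
    (Set.mem_univ _) (Set.mem_univ _)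
  rwa [mul_comm, Real.norm_eq_abs] at h

theorem IsUnitaryGroupOf.inner_apply (hU : IsUnitaryGroupOf D U) (t : ℝ) (ξ η : H) :
    inner ℂ (U t ξ) η = inner ℂ ξ (U (-t) η) := by
  have h : η = U t (U (-t) η) := by
    rw [← hU.apply_add, add_neg_cancel, hU.zero]; rfl
  have hi : ∀ x y : H, inner ℂ (U t x) (U t y) = inner ℂ x y := fun x y =>
    ContinuousLinearMap.inner_map_map_of_mem_unitary (hU.unitary t) x y
  conv_lhs => rw [h]
  exact hi _ _

/-- Both sides come from differentiating `⟨U (s + t) ξ, x⟩ = ⟨U s ξ, U (-t) x⟩` at `t = 0`. This is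
the identity that places `U s ξ` in the domain of the adjoint of `D`. -/
theorem IsUnitaryGroupOf.inner_apply_generator (hU : IsUnitaryGroupOf D U) (s : ℝ)
    (ξ x : D.domain) : inner ℂ (U s (D ξ)) (x : H) = inner ℂ (U s (ξ : H)) (D x) := by
  have h1 : HasDerivAt (fun t => inner ℂ (U (s + t) (ξ : H)) (x : H))
      (inner ℂ (U s (Complex.I • D ξ)) (x : H)) 0 := by
    have h0 : HasDerivAt (fun r => U r (ξ : H)) (U s (Complex.I • D ξ)) (s + 0) := by
      rw [add_zero]; exact hU.hasDerivAt_apply ξ s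
    have := (h0.comp_const_add s 0).inner ℂ (hasDerivAt_const (0 : ℝ) (x : H))
    rwa [inner_zero_right, zero_add] at this
  have h2 : HasDerivAt (fun t => inner ℂ (U (s + t) (ξ : H)) (x : H))
      (inner ℂ (U s (ξ : H)) (-(Complex.I • D x))) 0 := by
    have h0 : HasDerivAt (fun r => U r (x : H)) (Complex.I • D x) (-0) := by
      rw [neg_zero]; exact hU.hasDerivAt x
    have h := h0.scomp (0 : ℝ) (hasDerivAt_neg (0 : ℝ))
    rw [neg_smul, one_smul] at h
    have := (hasDerivAt_const (0 : ℝ) (U s (ξ : H))).inner ℂ h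
    simp only [inner_zero_left, add_zero] at this
    refine this.congr_of_eventuallyEq (Eventually.of_forall fun t => ?_)
    change inner ℂ (U (s + t) (ξ : H)) (x : H) = inner ℂ (U s (ξ : H)) (U (-t) (x : H))
    rw [add_comm, hU.apply_add, hU.inner_apply]
  have h3 := h1.unique h2
  rw [map_smul, inner_smul_left, inner_neg_right, inner_smul_right, Complex.conj_I, neg_mul,
    neg_inj] at h3
  exact mul_left_cancel₀ Complex.I_ne_zero h3

/-- The group commutes with its generator: the previous identity gives the claim for the adjoint of
`D`, which is `D` itself. -/
theorem IsUnitaryGroupOf.exists_generator_apply (hD : IsSelfAdjoint D)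
    (hU : IsUnitaryGroupOf D U) (s : ℝ) (ξ : D.domain) :
    ∃ h : U s (ξ : H) ∈ D.domain, D ⟨U s ξ, h⟩ = U s (D ξ) := by
  have hdom : U s (ξ : H) ∈ D.adjoint.domain :=
    LinearPMap.mem_adjoint_domain_of_exists _ ⟨_, hU.inner_apply_generator s ξ⟩
  have happ : D.adjoint ⟨U s (ξ : H), hdom⟩ = U s (D ξ) :=
    LinearPMap.adjoint_apply_eq hD.dense_domain _ (hU.inner_apply_generator s ξ)
  -- The domain membership depends on the operator, so the equality of `D` with its adjoint is used
  -- by substituting a variable `S`.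
  have key : ∀ S : H →ₗ.[ℂ] H, S = D → ∀ h : U s (ξ : H) ∈ S.domain, S ⟨U s ξ, h⟩ = U s (D ξ) →
      ∃ h : U s (ξ : H) ∈ D.domain, D ⟨U s ξ, h⟩ = U s (D ξ) := by
    rintro S rfl h hS
    exact ⟨h, hS⟩
  exact key _ (LinearPMap.isSelfAdjoint_def.mp hD) hdom happ

theorem IsUnitaryGroupOf.graphNorm_apply_le_one (hD : IsSelfAdjoint D)
    (hU : IsUnitaryGroupOf D U) (s : ℝ) {ξ : H} (hξ : graphNorm D ξ ≤ 1) :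
    graphNorm D (U s ξ) ≤ 1 := by
  obtain ⟨h, hle⟩ := graphNorm_le_one_iff.mp hξ
  obtain ⟨h', he⟩ := hU.exists_generator_apply hD s ⟨ξ, h⟩
  refine graphNorm_le_one_iff.mpr ⟨h', ?_⟩
  rw [hU.norm_apply]
  simp only at he
  rwa [he, hU.norm_apply]

/-- The differential equation behind the Laplace transform formula for the resolvent. -/
theorem IsUnitaryGroupOf.hasDerivAt_exp_mul_inner_resolvent (hU : IsUnitaryGroupOf D U) {z : ℂ}
    {R : H →L[ℂ] H} (hR : IsResolventAt D (starRingEnd ℂ z) R) (ξ a : H) (r : ℝ) :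
    HasDerivAt (fun t : ℝ => Complex.exp (Complex.I * z * t) * inner ℂ (U t (R ξ)) a)
      (-Complex.I * Complex.exp (Complex.I * z * r) * inner ℂ (U r ξ) a) r := by
  obtain ⟨x, hx1, hx2⟩ := hR.right_inv ξ
  have h1 : HasDerivAt (fun t => inner ℂ (U t (R ξ)) a) (inner ℂ (U r (Complex.I • D x)) a) r := by
    rw [← hx1]
    have := (hU.hasDerivAt_apply x r).inner ℂ (hasDerivAt_const r a)
    rwa [inner_zero_right, zero_add] at this
  have h2 : HasDerivAt (fun t : ℝ => Complex.exp (Complex.I * z * t))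
      (Complex.exp (Complex.I * z * r) * (Complex.I * z * 1)) r :=
    (((Complex.ofRealCLM.hasDerivAt (x := r)).const_mul (Complex.I * z))).cexp
  -- The first slot is conjugate-linear, so `conj z • R ξ` contributes `-i z ⟨U r (R ξ), a⟩`, which
  -- cancels the derivative of the exponential.
  have e : D x = ξ + starRingEnd ℂ z • R ξ := by rw [← hx1]; exact sub_eq_iff_eq_add.mp hx2
  refine (h2.mul h1).congr_deriv ?_
  rw [e, smul_add, map_add, map_smul, map_smul, map_smul, inner_add_left, inner_smul_left,
    inner_smul_left, inner_smul_left, Complex.conj_I, Complex.conj_conj]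
  ring

end UnitaryGroup

/-- If the orbits of two vectors are close in the sense of functionals on a time interval `[0, p]`,
then so are their images under the resolvents. -/
theorem norm_inner_resolvent_sub_le {H₁ H₂ : Type*} [NormedAddCommGroup H₁]
    [InnerProductSpace ℂ H₁] [CompleteSpace H₁] [NormedAddCommGroup H₂] [InnerProductSpace ℂ H₂]
    [CompleteSpace H₂] {D₁ : H₁ →ₗ.[ℂ] H₁} {D₂ : H₂ →ₗ.[ℂ] H₂} (hD₁ : IsSelfAdjoint D₁)
    (hD₂ : IsSelfAdjoint D₂) {U₁ : ℝ → H₁ →L[ℂ] H₁} {U₂ : ℝ → H₂ →L[ℂ] H₂}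
    (hU₁ : IsUnitaryGroupOf D₁ U₁) (hU₂ : IsUnitaryGroupOf D₂ U₂) {z : ℂ} (hz : z.im ≠ 0)
    {R₁ : H₁ →L[ℂ] H₁} {R₂ : H₂ →L[ℂ] H₂} (hR₁ : IsResolventAt D₁ (starRingEnd ℂ z) R₁)
    (hR₂ : IsResolventAt D₂ (starRingEnd ℂ z) R₂) {ξ a : H₁} {η b : H₂} (hξ : ‖ξ‖ ≤ 1)
    (hη : ‖η‖ ≤ 1) (ha : ‖a‖ ≤ 1) (hb : ‖b‖ ≤ 1) {S C : ℝ} (hS : 0 ≤ S)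
    (h : ∀ r : ℝ, |r| ≤ S → ‖inner ℂ (U₁ r ξ) a - inner ℂ (U₂ r η) b‖ ≤ C) :
    ‖inner ℂ (R₁ ξ) a - inner ℂ (R₂ η) b‖ ≤
      C * S + 2 * (Real.exp (-(S * |z.im|)) / |z.im|) := by
  have hm : 0 < |z.im| := abs_pos.mpr hz
  -- The endpoint `p` takes the sign of `Im z`, so that `e^{izt}` decays from 0 to `p`.
  obtain ⟨p, hpS, hpz⟩ : ∃ p : ℝ, |p| = S ∧ p * z.im = S * |z.im| := by
    rcases lt_or_gt_of_ne hz with h | h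
    · exact ⟨-S, by rw [abs_neg, abs_of_nonneg hS], by rw [abs_of_neg h]; ring⟩
    · exact ⟨S, abs_of_nonneg hS, by rw [abs_of_pos h]⟩
  have hexp : ∀ r : ℝ, ‖Complex.exp (Complex.I * z * r)‖ = Real.exp (-(r * z.im)) := fun r => by
    rw [Complex.norm_exp]
    congr 1
    simp
    ring
  -- `f 0` is the quantity to bound, `f p` is the exponentially small tail, and `f'` involves only
  -- the difference of the two orbits.
  let f : ℝ → ℂ := fun t => Complex.exp (Complex.I * z * t) * inner ℂ (U₁ t (R₁ ξ)) a -
    Complex.exp (Complex.I * z * t) * inner ℂ (U₂ t (R₂ η)) b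
  have hseg : ∀ r ∈ segment ℝ 0 p, |r| ≤ S ∧ 0 ≤ r * z.im := by
    rintro r ⟨α, β, hα, hβ, hαβ, rfl⟩
    simp only [smul_eq_mul, mul_zero, zero_add]
    refine ⟨?_, ?_⟩
    · rw [abs_mul, abs_of_nonneg hβ, hpS]
      nlinarith
    · rw [mul_assoc, hpz]
      positivity
  have hmvt := (convex_segment (𝕜 := ℝ) (0 : ℝ) p).norm_image_sub_le_of_norm_hasDerivWithin_le
    (f := f) (C := C) (x := p) (y := 0)
    (fun r _ => ((hU₁.hasDerivAt_exp_mul_inner_resolvent hR₁ ξ a r).sub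
      (hU₂.hasDerivAt_exp_mul_inner_resolvent hR₂ η b r)).hasDerivWithinAt)
    (fun r hr => by
      obtain ⟨h1, h2⟩ := hseg r hr
      rw [← mul_sub, norm_mul, norm_mul, norm_neg, Complex.norm_I, one_mul, hexp]
      have h3 : Real.exp (-(r * z.im)) ≤ 1 := Real.exp_le_one_iff.mpr (by linarith)
      have h4 := h r h1
      calc _ ≤ 1 * ‖inner ℂ (U₁ r ξ) a - inner ℂ (U₂ r η) b‖ := by gcongr
        _ ≤ C := by rwa [one_mul])
    (right_mem_segment ℝ 0 p) (left_mem_segment ℝ 0 p)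
  have hf0 : f 0 = inner ℂ (R₁ ξ) a - inner ℂ (R₂ η) b := by
    simp [f, hU₁.zero, hU₂.zero]
  -- Here `x` stands for the norm of a resolvent vector, at most `1 / |Im z|`, and `y` for the norm
  -- of `a` or `b`.
  have hbound : ∀ {x y : ℝ}, |z.im| * x ≤ 1 → 0 ≤ x → 0 ≤ y → y ≤ 1 → x * y ≤ 1 / |z.im| := by
    intro x y h1 h2 h3 h4
    rw [le_div_iff₀ hm]
    nlinarith
  have hn₁ : ‖inner ℂ (U₁ p (R₁ ξ)) a‖ ≤ 1 / |z.im| := by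
    refine (norm_inner_le_norm _ _).trans ?_
    rw [hU₁.norm_apply]
    have := (hR₁.norm_le hD₁ ξ).trans hξ
    rw [Complex.conj_im, abs_neg] at this
    exact hbound this (norm_nonneg _) (norm_nonneg _) ha
  have hn₂ : ‖inner ℂ (U₂ p (R₂ η)) b‖ ≤ 1 / |z.im| := by
    refine (norm_inner_le_norm _ _).trans ?_
    rw [hU₂.norm_apply]
    have := (hR₂.norm_le hD₂ η).trans hη
    rw [Complex.conj_im, abs_neg] at this
    exact hbound this (norm_nonneg _) (norm_nonneg _) hb
  have hfp : ‖f p‖ ≤ 2 * (Real.exp (-(S * |z.im|)) / |z.im|) := by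
    simp only [f]
    rw [← mul_sub, norm_mul, hexp, hpz]
    have h1 := norm_sub_le (inner ℂ (U₁ p (R₁ ξ)) a) (inner ℂ (U₂ p (R₂ η)) b)
    calc _ ≤ Real.exp (-(S * |z.im|)) * (1 / |z.im| + 1 / |z.im|) := by gcongr; linarith
      _ = _ := by ring
  rw [zero_sub, norm_neg, Real.norm_eq_abs, hpS] at hmvt
  rw [← hf0]
  have h1 := norm_add_le (f 0 - f p) (f p)
  rw [sub_add_cancel] at h1
  linarith

/-! ### Reach and separation -/

section Reach

/-- The module norm is determined by the inner product, and *-morphisms of C*-algebras are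
contractive. -/
theorem LipschitzMorphism.norm_onM_le {X Y : QuantumCorrespondence.{u, v, w}}
    (f : LipschitzMorphism X Y) (ω : X.M) : ‖f.onM ω‖ ≤ ‖ω‖ := by
  rw [Y.norm_eq, X.norm_eq, ← f.map_ip]
  exact Real.sqrt_le_sqrt (NonUnitalStarAlgHom.norm_apply_le f.onB _)

theorem IsIsoIso.abs_sub_lt {ε : ℝ} {ς₁ ς₂ : ℝ≥0 → ℝ≥0} (h : IsIsoIso ε ς₁ ς₂) (hε : 0 < ε)
    {t : ℝ≥0} (ht : (t : ℝ) ≤ 1 / ε) : |(t : ℝ) - ς₁ t| < ε ∧ |(t : ℝ) - ς₂ t| < ε := by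
  obtain ⟨h₁, h₂, h⟩ := h
  have h0 : ((0 : ℝ≥0) : ℝ) ≤ 1 / ε := by simpa using hε.le
  -- Taking `x = y = 0` and `z = t` reduces each inequality to `|t - ς t| < ε`; the one for `ς₂`
  -- comes first, hence the swap below.
  have := h 0 0 t h0 h0 ht
  simp only [h₁, h₂, NNReal.coe_zero, add_zero, zero_sub, abs_neg, NNReal.abs_eq] at this
  exact ⟨this.2, this.1⟩

/-! ### Pseudo-states over the scalars -/

theorem apply_eq_of_mem_stateSpace {μ : WeakDual ℂ ℂ} (hμ : μ ∈ StateSpace ℂ) (c : ℂ) :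
    μ c = c := by
  have h := map_smul μ c (1 : ℂ)
  rw [hμ.1] at h
  simpa using h

theorem exists_mem_stateSpace_complex : ∃ μ : WeakDual ℂ ℂ, μ ∈ StateSpace ℂ ∧ ∀ c, μ c = c :=
  ⟨StrongDual.toWeakDual (ContinuousLinearMap.id ℂ ℂ), ⟨rfl, fun a => star_mul_self_nonneg a⟩,
    fun _ => rfl⟩

/-- The only state of `ℂ` is the identity, so the state in a pseudo-state carries no information. -/
theorem SpectralTriple.mem_pseudoStates_iff (T : SpectralTriple.{u, v}) (φ : T.H →L[ℂ] ℂ) :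
    φ ∈ pseudoStates T.toCorrespondence ↔
      ∃ ξ : T.H, graphNorm T.D ξ ≤ 1 ∧ φ = innerSL ℂ ξ := by
  constructor
  · rintro ⟨μ, hμ, ξ, hξ, h⟩
    refine ⟨ξ, hξ, ?_⟩
    ext η
    exact (h η).trans (apply_eq_of_mem_stateSpace hμ _)
  · rintro ⟨ξ, hξ, rfl⟩
    obtain ⟨μ, hμ, h⟩ := exists_mem_stateSpace_complex
    exact ⟨μ, hμ, ξ, hξ, fun η => (h _).symm⟩

/-! ### From the reach of a tunnel to nearby orbits and resolvents -/

variable {F K G H : ℝ≥0} {T₁ T₂ : SpectralTriple.{u, v}}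

theorem exists_of_halfReach_lt (τ : Tunnel F K G H T₁.toCorrespondence T₂.toCorrespondence)
    {ς : ℝ≥0 → ℝ≥0} {ε : ℝ} (h : halfReach τ ς ε < ENNReal.ofReal ε) {ξ : T₁.H}
    (hξ : graphNorm T₁.D ξ ≤ 1) :
    ∃ η : T₂.H, graphNorm T₂.D η ≤ 1 ∧ ∀ t : ℝ≥0, (t : ℝ) ≤ 1 / ε → ∀ ω : τ.P.M, τ.P.DN ω ≤ 1 →
      ‖inner ℂ (T₁.unitaryGroup (-(t : ℝ)) ξ) (τ.left.onM ω) -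
        inner ℂ (T₂.unitaryGroup (-(ς t : ℝ)) η) (τ.right.onM ω)‖ ≤ ε := by
  have h1 := (le_iSup₂ (f := fun x _ => ⨅ y ∈ _, kantorovichFamily τ.P x y) _
    ⟨ξ, hξ, rfl⟩).trans_lt h
  simp only [iInf_lt_iff] at h1
  obtain ⟨_, ⟨η, hη, rfl⟩, h2⟩ := h1
  refine ⟨η, hη, fun t ht ω hω => ?_⟩
  have h3 := ((le_iSup_of_le (⟨t, ht⟩ : {t : ℝ≥0 // (t : ℝ) ≤ 1 / ε})
    (le_iSup₂_of_le ω hω le_rfl)).trans_lt h2).le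
  rw [← ofReal_norm] at h3
  have hε : 0 < ε := ENNReal.ofReal_pos.mp (pos_of_gt h)
  exact (ENNReal.ofReal_le_ofReal_iff hε.le).mp h3

/-- This removes `ς` and the restriction on the sign of time. One `ε` comes from the reach, the
other from replacing `ς t` by `t`. -/
theorem exists_orbit_of_halfReach_lt
    (τ : Tunnel F K G H T₁.toCorrespondence T₂.toCorrespondence)
    {ς : ℝ≥0 → ℝ≥0} {ε : ℝ} (hς : ∀ t : ℝ≥0, (t : ℝ) ≤ 1 / ε → |(t : ℝ) - ς t| < ε)
    (h : halfReach τ ς ε < ENNReal.ofReal ε) {S : ℝ} (hSε : 2 * S ≤ 1 / ε) {ξ : T₁.H}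
    (hξ : graphNorm T₁.D ξ ≤ 1) :
    ∃ η : T₂.H, graphNorm T₂.D η ≤ 1 ∧ ∀ r : ℝ, |r| ≤ S → ∀ ω : τ.P.M, τ.P.DN ω ≤ 1 →
      ‖inner ℂ (T₁.unitaryGroup r ξ) (τ.left.onM ω) -
        inner ℂ (T₂.unitaryGroup r η) (τ.right.onM ω)‖ ≤ 2 * ε := by
  have hU₁ := T₁.isUnitaryGroupOf_unitaryGroup
  have hU₂ := T₂.isUnitaryGroupOf_unitaryGroup
  -- The reach is applied to `U₁ S ξ` and the vector obtained is moved back by `U₂ (-S)`: the time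
  -- `-t`, with `t = S - r` in `[0, 2 S]`, becomes `r` in `[-S, S]`.
  obtain ⟨η, hη, hclose⟩ := exists_of_halfReach_lt τ h
    (hU₁.graphNorm_apply_le_one T₁.selfAdjoint_D S hξ)
  refine ⟨T₂.unitaryGroup (-S) η, hU₂.graphNorm_apply_le_one T₂.selfAdjoint_D (-S) hη,
    fun r hr ω hω => ?_⟩
  obtain ⟨hr1, hr2⟩ := abs_le.mp hr
  let t : ℝ≥0 := ⟨S - r, by linarith⟩
  have htS : (t : ℝ) = S - r := rfl
  have ht : (t : ℝ) ≤ 1 / ε := by rw [htS]; linarith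
  have h1 := hclose t ht ω hω
  rw [← hU₁.apply_add, show -(t : ℝ) + S = r by rw [htS]; ring] at h1
  rw [← hU₂.apply_add, show r + -S = -(t : ℝ) by rw [htS]; ring]
  obtain ⟨hdom, hle⟩ := graphNorm_le_one_iff.mp hη
  have hω1 : ‖τ.right.onM ω‖ ≤ 1 := by
    refine (τ.right.norm_onM_le ω).trans ?_
    have := (τ.isMetrical.norm_le ω).trans hω
    rwa [← ofReal_norm, ENNReal.ofReal_le_one] at this
  -- The orbit of `η` is Lipschitz with constant `‖D η‖ ≤ 1`, and `|t - ς t| < ε`.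
  have h2 : ‖inner ℂ (T₂.unitaryGroup (-(ς t : ℝ)) η) (τ.right.onM ω) -
      inner ℂ (T₂.unitaryGroup (-(t : ℝ)) η) (τ.right.onM ω)‖ ≤ ε := by
    rw [← inner_sub_left]
    have h3 := hU₂.norm_sub_le ⟨η, hdom⟩ (-(ς t : ℝ)) (-(t : ℝ))
    rw [show -(ς t : ℝ) - -(t : ℝ) = (t : ℝ) - ς t by ring] at h3
    have h4 := hς t ht
    have h5 : ‖T₂.D ⟨η, hdom⟩‖ ≤ 1 := by linarith [norm_nonneg η]
    calc _ ≤ _ := norm_inner_le_norm _ _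
      _ ≤ (|(t : ℝ) - ς t| * ‖T₂.D ⟨η, hdom⟩‖) * 1 :=
        mul_le_mul h3 hω1 (norm_nonneg _) (by positivity)
      _ ≤ (ε * 1) * 1 := by gcongr; exact (abs_nonneg _).trans h4.le
      _ = ε := by ring
  have h3 := norm_sub_le_norm_sub_add_norm_sub
    (inner ℂ (T₁.unitaryGroup r ξ) (τ.left.onM ω))
    (inner ℂ (T₂.unitaryGroup (-(ς t : ℝ)) η) (τ.right.onM ω))
    (inner ℂ (T₂.unitaryGroup (-(t : ℝ)) η) (τ.right.onM ω))
  linarith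

theorem hausdorffFrom_resolvent_le
    (τ : Tunnel F K G H T₁.toCorrespondence T₂.toCorrespondence)
    {ς : ℝ≥0 → ℝ≥0} {ε : ℝ} (hς : ∀ t : ℝ≥0, (t : ℝ) ≤ 1 / ε → |(t : ℝ) - ς t| < ε)
    (h : halfReach τ ς ε < ENNReal.ofReal ε) {S : ℝ} (hS : 0 ≤ S) (hSε : 2 * S ≤ 1 / ε) {J : Type*}
    (z : ℂ) (hz : z.im ≠ 0) :
    hausdorffFrom (kantorovichFamily τ.P)
      {Φ : J → τ.P.M →L[ℂ] ℂ | ∃ φ ∈ pseudoStates T₁.toCorrespondence,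
        Φ = fun _ => φ.comp ((T₁.resolvent z hz).comp τ.left.onM)}
      {Ψ : J → τ.P.M →L[ℂ] ℂ | ∃ ψ ∈ pseudoStates T₂.toCorrespondence,
        Ψ = fun _ => ψ.comp ((T₂.resolvent z hz).comp τ.right.onM)} ≤
      ENNReal.ofReal (2 * ε * S + 2 * (Real.exp (-(S * |z.im|)) / |z.im|)) := by
  have hz' : (starRingEnd ℂ z).im ≠ 0 := by rwa [Complex.conj_im, neg_ne_zero]
  refine iSup₂_le ?_
  rintro _ ⟨φ, hφ, rfl⟩
  obtain ⟨ξ, hξ, rfl⟩ := (T₁.mem_pseudoStates_iff φ).mp hφ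
  obtain ⟨η, hη, hclose⟩ := exists_orbit_of_halfReach_lt τ hς h hSε hξ
  refine iInf₂_le_of_le _ ⟨_, (T₂.mem_pseudoStates_iff _).mpr ⟨η, hη, rfl⟩, rfl⟩ ?_
  refine iSup_le fun _ => iSup₂_le fun ω hω => ?_
  rw [← ofReal_norm]
  refine ENNReal.ofReal_le_ofReal ?_
  change ‖inner ℂ ξ (T₁.resolvent z hz (τ.left.onM ω)) -
    inner ℂ η (T₂.resolvent z hz (τ.right.onM ω))‖ ≤ _
  have hR₁ := T₁.isResolventAt_resolvent _ hz'
  have hR₂ := T₂.isResolventAt_resolvent _ hz'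
  -- The resolvent at `z` moves to the other slot as the resolvent at `conj z`, where it acts on the
  -- vectors whose orbits are compared.
  rw [← hR₁.inner_symm T₁.selfAdjoint_D (T₁.isResolventAt_resolvent z hz)
      (Complex.conj_conj z).symm,
    ← hR₂.inner_symm T₂.selfAdjoint_D (T₂.isResolventAt_resolvent z hz)
      (Complex.conj_conj z).symm]
  have hω1 : ‖ω‖ ≤ 1 := by
    have := (τ.isMetrical.norm_le ω).trans hω
    rwa [← ofReal_norm, ENNReal.ofReal_le_one] at this
  obtain ⟨_, hξ1⟩ := graphNorm_le_one_iff.mp hξ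
  obtain ⟨_, hη1⟩ := graphNorm_le_one_iff.mp hη
  exact norm_inner_resolvent_sub_le T₁.selfAdjoint_D T₂.selfAdjoint_D
    T₁.isUnitaryGroupOf_unitaryGroup T₂.isUnitaryGroupOf_unitaryGroup hz hR₁ hR₂
    ((le_add_of_nonneg_right (norm_nonneg _)).trans hξ1)
    ((le_add_of_nonneg_right (norm_nonneg _)).trans hη1)
    ((τ.left.norm_onM_le ω).trans hω1) ((τ.right.norm_onM_le ω).trans hω1) hS
    fun r hr => hclose r hr ω hω

/-- The tunnel and its reverse, with `ς₁` and `ς₂` respectively, give the two halves of the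
Hausdorff distance. -/
theorem operationalPropinquity_resolvent_le
    (τ : Tunnel F K G H T₁.toCorrespondence T₂.toCorrespondence)
    {ς₁ ς₂ : ℝ≥0 → ℝ≥0} {ε : ℝ} (hε : 0 < ε) (hς : IsIsoIso ε ς₁ ς₂)
    (h : magnitude τ ς₁ ς₂ ε < ENNReal.ofReal ε) {S : ℝ} (hS : 0 ≤ S) (hSε : 2 * S ≤ 1 / ε)
    {J : Type*} (z : ℂ) (hz : z.im ≠ 0) :
    operationalPropinquity F K G H (X := T₁.toCorrespondence) (Y := T₂.toCorrespondence)
        (fun _ : J => ⟨T₁.resolvent z hz, T₁.mem_adjointable _⟩)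
        (fun _ : J => ⟨T₂.resolvent z hz, T₂.mem_adjointable _⟩) ≤
      ENNReal.ofReal (max ε (2 * ε * S + 2 * (Real.exp (-(S * |z.im|)) / |z.im|))) := by
  obtain ⟨hext, hreach⟩ := max_lt_iff.mp h
  obtain ⟨hreach₁, hreach₂⟩ := max_lt_iff.mp hreach
  refine iInf_le_of_le τ (max_le ?_ (max_le ?_ ?_))
  · exact hext.le.trans (ENNReal.ofReal_le_ofReal (le_max_left _ _))
  · exact (hausdorffFrom_resolvent_le τ (fun t ht => (hς.abs_sub_lt hε ht).1) hreach₁ hS hSε z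
      hz).trans (ENNReal.ofReal_le_ofReal (le_max_right _ _))
  · exact (hausdorffFrom_resolvent_le τ.symm (fun t ht => (hς.abs_sub_lt hε ht).2) hreach₂ hS hSε z
      hz).trans (ENNReal.ofReal_le_ofReal (le_max_right _ _))

/-- Below `√2 / 2` the value inserted in the infimum plays no role, so an actual tunnel is found. -/
theorem exists_tunnel_of_spectralPropinquity_lt {δ : ℝ} (hδ : δ ≤ √2 / 2)
    (h : spectralPropinquity F K G H T₁ T₂ < δ) :
    ∃ ε : ℝ, 0 < ε ∧ ε < δ ∧
      ∃ (τ : Tunnel F K G H T₁.toCorrespondence T₂.toCorrespondence) (ς₁ ς₂ : ℝ≥0 → ℝ≥0),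
        IsIsoIso ε ς₁ ς₂ ∧ magnitude τ ς₁ ς₂ ε < ENNReal.ofReal ε := by
  obtain ⟨ε, hε, hlt⟩ := exists_lt_of_csInf_lt (Set.insert_nonempty _ _) h
  rcases hε with rfl | ⟨hpos, hex⟩
  · exact absurd hlt hδ.not_gt
  · exact ⟨ε, hpos, hlt, hex⟩

end Reach

end SpectralPropinquity

/-! ### Choice of the truncation time and of the tunnel -/

theorem mainTheorem12 (F K G H : NNReal) (hF : 1 ≤ F) (hG : 1 ≤ G) (hH : 2 ≤ H)
    (T : ℕ → SpectralPropinquity.SpectralTriple.{u, v}) (T' : SpectralPropinquity.SpectralTriple.{u, v})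
    (hT : ∀ n, (T n).IsMetric) (hT' : T'.IsMetric)
    (hconv : Filter.Tendsto (fun n => SpectralPropinquity.spectralPropinquity F K G H (T n) T') Filter.atTop
      (nhds 0))
    (z : ℂ) (hz : z.im ≠ 0) :
    Filter.Tendsto
      (fun n => SpectralPropinquity.operationalPropinquity F K G H
        (X := (T n).toCorrespondence) (Y := T'.toCorrespondence)
        (fun _ : Fin 1 => ⟨(T n).resolvent z hz, (T n).mem_adjointable _⟩)
        (fun _ : Fin 1 => ⟨T'.resolvent z hz, T'.mem_adjointable _⟩))
      Filter.atTop (nhds 0) := by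
  have hm : 0 < |z.im| := abs_pos.mpr hz
  rw [ENNReal.tendsto_nhds_zero]
  intro δ hδ
  obtain ⟨d, hd0, hdδ⟩ := ENNReal.lt_iff_exists_nnreal_btwn.mp hδ
  have hd : (0 : ℝ) < d := by exact_mod_cast hd0
  have hlim : Filter.Tendsto (fun S : ℝ => 2 * (Real.exp (-(S * |z.im|)) / |z.im|)) Filter.atTop
      (nhds 0) := by
    have h1 := Real.tendsto_exp_neg_atTop_nhds_zero.comp (Filter.tendsto_id.atTop_mul_const hm)
    simpa using (h1.div_const |z.im|).const_mul 2
  -- `S` depends only on `d` and `|Im z|`; it makes the tail smaller than `d / 2` and is fixed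
  -- before `ε`.
  obtain ⟨S, hSd, hS⟩ := ((hlim.eventually (gt_mem_nhds (half_pos hd))).and
    (Filter.eventually_gt_atTop 0)).exists
  -- The four bounds on `ε` serve in turn to exclude the inserted value `√2 / 2`, to bound the
  -- extent by `d`, to get `2 ε S < d / 2`, and to fit `[0, 2 S]` in `[0, 1 / ε]`.
  have hpos : 0 < min (√2 / 2) (min (d : ℝ) (min (d / (4 * S)) (1 / (2 * S)))) := by positivity
  filter_upwards [hconv.eventually (gt_mem_nhds hpos)] with n hn
  obtain ⟨ε, hε, hlt, τ, ς₁, ς₂, hς, hmag⟩ :=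
    SpectralPropinquity.exists_tunnel_of_spectralPropinquity_lt (min_le_left _ _) hn
  simp only [lt_min_iff] at hlt
  obtain ⟨-, h1, h2, h3⟩ := hlt
  rw [lt_div_iff₀ (by positivity)] at h2 h3
  have hSε : 2 * S ≤ 1 / ε := by
    rw [le_div_iff₀ hε]; linarith
  refine (SpectralPropinquity.operationalPropinquity_resolvent_le τ hε hς hmag hS.le hSε z
    hz).trans (le_trans ?_ hdδ.le)
  rw [← ENNReal.ofReal_coe_nnreal]
  exact ENNReal.ofReal_le_ofReal (max_le h1.le (by linarith))
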